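/- Let $\mathbb{D}=\{z\in\mathbb{C}:|z|<1\}$. Let $\mathcal{H}$ be the class of complex-valued harmonic functions $f=h+\overline{g}$ in $\mathbb{D}$, where $h$ and $g$ are analytic in $\mathbb{D}$ with expansions $h(z)=z+\sum_{n=2}^{\infty}a_nz^n$ and $g(z)=\sum_{n=1}^{\infty}b_nz^n$. A function $f\in\mathcal{H}$ is called absolutely convex in $\mathbb{D}$ if it is locally univalent in $\mathbb{D}$ and the image $f(\{z:|z-a|<r\})$ is convex for all $a\in\mathbb{D}$ and all $r\in(0,1-|a|)$. Let $\mathcal{AK}^0_H$ denote the class of all absolutely convex $f=h+\overline{g}\in\mathcal{H}$ with $g'(0)=0$. Let $f\in\mathcal{AK}^0_H$. Then the coefficient $a_2$ satisfies $|a_2|\le 2/\sqrt{3}$. Moreover, $$\frac{\sqrt{3}}{\sqrt{3}+4}\left[1-\left(\frac{1-r}{1+r}\right)^{\frac{\sqrt{3}+4}{2\sqrt{3}}}\right]\le |f(z)|\le \frac{\sqrt{3}}{\sqrt{3}+4}\left[\left(\frac{1+r}{1-r}\right)^{\frac{\sqrt{3}+4}{2\sqrt{3}}}-1\right]$$ whenever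 $0<|z|=r<1$. In particular, the range $f(\mathbb{D})$ contains the disk $|w|<\sqrt{3}/(\sqrt{3}+4)$. -/

import Mathlib

namespace HarmonicMapping

/-- The pair `(h, g)` is the canonical decomposition `f = h + conj g` in the open unit disk of a
normalized complex-valued harmonic function `f`:  `h` and `g` are analytic in the disk, with
`h(z) = z + a₂ z² + a₃ z³ + ⋯` and `g(z) = b₁ z + b₂ z² + ⋯`. -/
structure IsNormalizedDecomp (f h g : ℂ → ℂ) : Prop where
  analytic_h : AnalyticOnNhd ℂ h (Metric.ball 0 1)
  analytic_g : AnalyticOnNhd ℂ g (Metric.ball 0 1)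
  h_zero : h 0 = 0
  deriv_h_zero : deriv h 0 = 1
  g_zero : g 0 = 0
  eq_add_conj : ∀ z ∈ Metric.ball (0 : ℂ) 1, f z = h z + (starRingEnd ℂ) (g z)

/-- The class `𝓗` of normalized complex-valued harmonic functions in the open unit disk.
Only the values of `f` in the disk matter. -/
def classH : Set (ℂ → ℂ) := {f | ∃ h g : ℂ → ℂ, IsNormalizedDecomp f h g}

/-- `f` is locally univalent (locally injective) in the open unit disk. -/
def IsLocallyUnivalent (f : ℂ → ℂ) : Prop :=
  ∀ z ∈ Metric.ball (0 : ℂ) 1, ∃ U ∈ nhds z, Set.InjOn f U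

/-- The class `𝓐𝓚_H` of absolutely convex harmonic functions: the locally univalent `f ∈ 𝓗` that
map every disk `{z : |z - a| < r}` with `|a| < 1` and `0 < r < 1 - |a|` onto a convex set. -/
def classAK : Set (ℂ → ℂ) :=
  {f | f ∈ classH ∧ IsLocallyUnivalent f ∧
    ∀ a ∈ Metric.ball (0 : ℂ) 1, ∀ r ∈ Set.Ioo (0 : ℝ) (1 - ‖a‖),
      Convex ℝ (f '' Metric.ball a r)}

/-- The class `𝓐𝓚⁰_H` of those `f = h + conj g` in `𝓐𝓚_H` with `g'(0) = 0`. -/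
def classAK0 : Set (ℂ → ℂ) :=
  {f | f ∈ classAK ∧ ∃ h g : ℂ → ℂ, IsNormalizedDecomp f h g ∧ deriv g 0 = 0}

/-- The `n`-th Taylor coefficient at `0` of a function analytic near `0`. -/
noncomputable def taylorCoeff (h : ℂ → ℂ) (n : ℕ) : ℂ :=
  iteratedDeriv n h 0 / (n.factorial : ℂ)

end HarmonicMapping

/-!
Write `f = h + conj g` in the unit disk `D`, and put `α = 2/√3 + 1/2`.

**Univalence.** By Lewy's theorem (`norm_deriv_ne_of_injOn`) a locally injective harmonic map has
nonvanishing Jacobian, so `|g'| < |h'|` on all of `D` as this holds at `0`. Convexity of the images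
of the disks `|z| < r` then makes `f` injective on `D` (`injOn_of_convex_images`): at the first
radius at which two points acquire a common image `w`, a line supports the convex image at `w`, and
points slightly inside that line have preimages in the open disk near both points.

**Second coefficient.** Let `z` lie on the boundary of a disk `B` inside `D`. By injectivity `f z` is
a boundary point of the convex set `f(B)`, and a supporting functional composed with `f` has a
maximum along the circle at `z`; the second derivative test gives an inequality between `h'`, `h''`,
`g''` at `z` when `g'(z) = 0` (`AbsConvexPair.curvature_nonneg`). Letting `B` grow until it touches
the unit circle, and varying its direction, one finds that the trigonometric polynomial
`1 + Re (e a) + Re (e³ b)` is nonnegative on `|e| = 1`, where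
`a = (1 - |z|²) h''(z) / (2 h'(z)) - conj z`. Averaging over two points `e₀ exp (± iπ/6)` kills the
cubic term and leaves `|a| ≤ 2/√3` (`norm_le_of_trig_nonneg`). At `z = 0` this is the bound on `a₂`.

**Growth.** The hypotheses are invariant under `f ↦ f + c conj f`, `|c| < 1`
(`AbsConvexPair.affine`), and a suitable `c` achieves `g'(z) = 0` at any prescribed `z`. Together
with the Schwarz-Pick bound for the dilatation this shows that, for all `|ε| ≤ 1`, the function
`K = h + ε g` satisfies `|(1 - |z|²) K''/(2 K') - conj z| ≤ α` in `D`
(`AbsConvexPair.norm_preSchwarzian_add_le`). Integrating along rays bounds `|h'| + |g'|` from above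
and `|h'| - |g'|` from below (`AbsConvexPair.distortion`). A second integration, along a ray for the
upper estimate and along the preimage of the segment `[0, f z]` for the lower one, gives the growth
theorem; the covering theorem follows by connectedness.
-/

namespace HarmonicMapping

open Complex Metric Set Filter Topology ComplexConjugate

/-! ### The real derivative of `h + conj g` -/

/-- The real-linear map `v ↦ A v + conj (B v)`: the real derivative of `h + conj g` at a point where
`h' = A` and `g' = B`. -/
noncomputable def harmDeriv (A B : ℂ) : ℂ →L[ℝ] ℂ :=
  ContinuousLinearMap.mul ℝ ℂ A +
    (Complex.conjCLE : ℂ →L[ℝ] ℂ).comp (ContinuousLinearMap.mul ℝ ℂ B)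

@[simp] lemma harmDeriv_apply (A B v : ℂ) : harmDeriv A B v = A * v + conj (B * v) := by
  simp [harmDeriv]

lemma hasStrictFDerivAt_add_conj {h g : ℂ → ℂ} {A B z : ℂ} (hh : HasStrictDerivAt h A z)
    (hg : HasStrictDerivAt g B z) :
    HasStrictFDerivAt (fun w => h w + conj (g w)) (harmDeriv A B) z := by
  have h1 := hh.hasStrictFDerivAt.restrictScalars ℝ
  have h2 := (Complex.conjCLE : ℂ →L[ℝ] ℂ).hasStrictFDerivAt.comp z
    (hg.hasStrictFDerivAt.restrictScalars ℝ)
  refine (h1.add h2).congr_fderiv ?_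
  ext v
  simp
  ring

lemma norm_harmDeriv_ge (A B v : ℂ) : (‖A‖ - ‖B‖) * ‖v‖ ≤ ‖harmDeriv A B v‖ := by
  rw [harmDeriv_apply]
  have := norm_sub_le_norm_add (A * v) (conj (B * v))
  rw [RCLike.norm_conj, norm_mul, norm_mul] at this
  linarith

lemma norm_harmDeriv_le (A B v : ℂ) : ‖harmDeriv A B v‖ ≤ (‖A‖ + ‖B‖) * ‖v‖ := by
  rw [harmDeriv_apply]
  have := norm_add_le (A * v) (conj (B * v))
  rw [RCLike.norm_conj, norm_mul, norm_mul] at this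
  linarith

/-- Sense-preserving differentials are invertible. -/
lemma exists_equiv_harmDeriv {A B : ℂ} (hAB : ‖B‖ < ‖A‖) :
    ∃ T : ℂ ≃L[ℝ] ℂ, (T : ℂ →L[ℝ] ℂ) = harmDeriv A B := by
  have hinj : Function.Injective (harmDeriv A B : ℂ →ₗ[ℝ] ℂ) := by
    rw [injective_iff_map_eq_zero]
    intro v hv
    have h1 := norm_harmDeriv_ge A B v
    have h2 : harmDeriv A B v = 0 := hv
    rw [h2, norm_zero] at h1
    by_contra hne
    have := mul_pos (sub_pos.2 hAB) (norm_pos_iff.2 hne)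
    linarith
  refine ⟨(LinearEquiv.ofInjectiveEndo _ hinj).toContinuousLinearEquiv, ?_⟩
  ext v
  simp

/-! ### Lewy's theorem -/

/-- Three arcs issuing from a common point and otherwise disjoint do not embed in a line: two of the
endpoints lie on the same side of the common point, and the nearer of the two is a value of the
other arc. -/
lemma not_three_arcs_into_line {q : Fin 3 → ℝ → ℝ} {c : ℝ}
    (hcont : ∀ k, ContinuousOn (q k) (Icc 0 1)) (h0 : ∀ k, q k 0 = c)
    (hne : ∀ k, q k 1 ≠ c)
    (hdisj : ∀ j k, ∀ s ∈ Ioc (0 : ℝ) 1, ∀ t ∈ Ioc (0 : ℝ) 1, q j s = q k t → j = k) : False := by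
  have key : ∀ j k, c < q j 1 → q j 1 ≤ q k 1 → j = k := by
    intro j k h1 h2
    obtain ⟨t, ht, hqt⟩ := intermediate_value_Icc zero_le_one (hcont k)
      (show q j 1 ∈ Icc (q k 0) (q k 1) from ⟨by rw [h0]; exact h1.le, h2⟩)
    have ht0 : t ≠ 0 := by rintro rfl; rw [h0] at hqt; linarith
    exact hdisj j k 1 (by simp) t ⟨lt_of_le_of_ne ht.1 ht0.symm, ht.2⟩ hqt.symm
  have key' : ∀ j k, q j 1 < c → q k 1 ≤ q j 1 → j = k := by
    intro j k h1 h2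
    obtain ⟨t, ht, hqt⟩ := intermediate_value_Icc' zero_le_one (hcont k)
      (show q j 1 ∈ Icc (q k 1) (q k 0) from ⟨h2, by rw [h0]; exact h1.le⟩)
    have ht0 : t ≠ 0 := by rintro rfl; rw [h0] at hqt; linarith
    exact hdisj j k 1 (by simp) t ⟨lt_of_le_of_ne ht.1 ht0.symm, ht.2⟩ hqt.symm
  have pair : ∀ j k, j ≠ k → (q j 1 < c ↔ c < q k 1) := by
    intro j k hjk
    rcases lt_or_gt_of_ne (hne j) with h1 | h1 <;> rcases lt_or_gt_of_ne (hne k) with h2 | h2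
    · rcases le_total (q j 1) (q k 1) with h | h
      · exact absurd (key' k j h2 h) hjk.symm
      · exact absurd (key' j k h1 h) hjk
    · exact ⟨fun _ => h2, fun _ => h1⟩
    · exact ⟨fun h => by linarith, fun h => by linarith⟩
    · rcases le_total (q j 1) (q k 1) with h | h
      · exact absurd (key j k h1 h) hjk
      · exact absurd (key k j h2 h) hjk.symm
  have p01 := pair 0 1 (by decide)
  have p02 := pair 0 2 (by decide)
  have p12 := pair 1 2 (by decide)
  have p21 := pair 2 1 (by decide)
  rcases lt_or_gt_of_ne (hne 0) with h | h
  · have := p12.2 (p02.1 h)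
    have := p01.1 h
    linarith
  · have a1 : ¬ c < q 1 1 := fun h' => by have := p01.2 h'; linarith
    have a2 : ¬ c < q 2 1 := fun h' => by have := p02.2 h'; linarith
    have b1 := lt_of_le_of_ne (not_lt.1 a1) (hne 1)
    exact a2 (p12.1 b1)

/-- At a critical point a nonconstant analytic function is `F z₀ + x ^ n` with `n ≥ 2` in a suitable
local coordinate `x`; `Ψ` is the inverse of the coordinate. -/
lemma exists_pow_coordinate {F : ℂ → ℂ} {z₀ : ℂ} (hF : AnalyticAt ℂ F z₀)
    (hnc : ¬ ∀ᶠ z in 𝓝 z₀, F z = F z₀) (hF' : deriv F z₀ = 0) :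
    ∃ n : ℕ, 2 ≤ n ∧ ∃ Ψ : ℂ → ℂ, Ψ 0 = z₀ ∧ (∀ᶠ x in 𝓝 (0 : ℂ), ContinuousAt Ψ x) ∧
      (∃ V ∈ 𝓝 (0 : ℂ), InjOn Ψ V) ∧ ∀ᶠ x in 𝓝 (0 : ℂ), F (Ψ x) = F z₀ + x ^ n := by
  have hF1 : AnalyticAt ℂ (fun z => F z - F z₀) z₀ := hF.sub analyticAt_const
  obtain ⟨n, G, hG, hG0, hFG⟩ := hF1.exists_eventuallyEq_pow_smul_nonzero_iff.2
    (by simpa [sub_eq_zero] using hnc)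
  have hn0 : n ≠ 0 := by
    rintro rfl
    have := hFG.self_of_nhds
    simp at this
    exact hG0 this.symm
  obtain ⟨c, hc⟩ := IsAlgClosed.exists_pow_nat_eq (G z₀) (Nat.pos_of_ne_zero hn0)
  have hc0 : c ≠ 0 := by rintro rfl; rw [zero_pow hn0] at hc; exact hG0 hc.symm
  -- dividing by `G z₀` moves the base point to `1`, where the principal root is analytic
  set R : ℂ → ℂ := fun z => c * (G z / G z₀) ^ ((n : ℂ)⁻¹) with hR
  have hRan : AnalyticAt ℂ R z₀ := by
    refine analyticAt_const.mul (AnalyticAt.cpow (hG.div analyticAt_const hG0) analyticAt_const ?_)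
    simp [div_self hG0]
  have hRn : ∀ z, R z ^ n = G z := by
    intro z
    rw [hR]
    simp only [mul_pow, Complex.cpow_nat_inv_pow _ hn0, hc]
    field_simp
  have hR0 : R z₀ = c := by simp [hR, div_self hG0]
  set ζ : ℂ → ℂ := fun z => (z - z₀) * R z with hζ
  have hζan : AnalyticAt ℂ ζ z₀ := (analyticAt_id.sub analyticAt_const).mul hRan
  have hζd : HasDerivAt ζ c z₀ := by
    have h1 := ((hasDerivAt_id z₀).sub_const z₀).mul hRan.differentiableAt.hasDerivAt
    simp only [id, sub_self, zero_mul, add_zero, one_mul, hR0] at h1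
    exact h1
  have hζs : HasStrictDerivAt ζ c z₀ := by
    have := hζan.hasStrictDerivAt
    rwa [hζd.deriv] at this
  have hFz : ∀ᶠ z in 𝓝 z₀, F z = F z₀ + ζ z ^ n := by
    filter_upwards [hFG] with z hz
    rw [hζ]
    simp only [mul_pow, hRn]
    rw [← smul_eq_mul, ← hz]; ring
  have hn2 : 2 ≤ n := by
    by_contra hlt
    have hn1 : n = 1 := by omega
    subst hn1
    have : HasDerivAt F c z₀ := by
      have h1 : HasDerivAt (fun z => F z₀ + ζ z ^ 1) c z₀ := by
        simpa using hζd.const_add (F z₀)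
      exact h1.congr_of_eventuallyEq hFz
    rw [this.deriv] at hF'
    exact hc0 hF'
  have hfd : HasStrictFDerivAt ζ
      ((ContinuousLinearEquiv.unitsEquivAut ℂ (Units.mk0 c hc0) : ℂ ≃L[ℂ] ℂ) : ℂ →L[ℂ] ℂ) z₀ := by
    refine hζs.hasStrictFDerivAt.congr_fderiv ?_
    ext; simp
  have hζ0 : ζ z₀ = 0 := by simp [hζ]
  set P := hfd.toOpenPartialHomeomorph ζ with hP
  have hPc : (P : ℂ → ℂ) = ζ := hfd.toOpenPartialHomeomorph_coe
  have hmem : z₀ ∈ P.source := hfd.mem_toOpenPartialHomeomorph_source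
  have htgt : (0 : ℂ) ∈ P.target := by
    have := P.map_source hmem
    rwa [hPc, hζ0] at this
  have hsymm0 : P.symm 0 = z₀ := by
    have := P.left_inv hmem
    rwa [hPc, hζ0] at this
  have hct : ∀ᶠ x in 𝓝 (0 : ℂ), x ∈ P.target := P.open_target.mem_nhds htgt
  refine ⟨n, hn2, P.symm, hsymm0, ?_, ⟨P.target, P.open_target.mem_nhds htgt, P.symm.injOn⟩, ?_⟩
  · filter_upwards [hct] with x hx using P.symm.continuousAt hx
  · have hcont : Tendsto P.symm (𝓝 0) (𝓝 z₀) := by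
      have := P.symm.continuousAt (x := 0) htgt
      rwa [ContinuousAt, hsymm0] at this
    filter_upwards [hct, hcont.eventually hFz] with x hx hx2
    rw [hx2, ← hPc, P.right_inv hx]

/-- A function is not injective near `z₀` if it maps three curves issuing from `z₀`, the images
under the injective map `Ψ` of three rays, into one line. The linear functional is
`w ↦ Re (u w)`. -/
lemma not_injOn_of_three_rays {f Ψ : ℂ → ℂ} {z₀ u : ℂ} {U : Set ℂ} (hu : u ≠ 0)
    (hf : ∀ᶠ z in 𝓝 z₀, ContinuousAt f z) (hU : U ∈ 𝓝 z₀) (hinj : InjOn f U)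
    (hΨ0 : Ψ 0 = z₀) (hΨc : ∀ᶠ x in 𝓝 (0 : ℂ), ContinuousAt Ψ x)
    (hΨi : ∃ V ∈ 𝓝 (0 : ℂ), InjOn Ψ V) (e : Fin 3 → ℂ) (he : ∀ k, ‖e k‖ = 1)
    (hei : Function.Injective e)
    (hline : ∀ᶠ x in 𝓝 (0 : ℂ), ∀ k, ∀ s : ℝ, x = s * e k → (u * f (Ψ x)).re = (u * f z₀).re) :
    False := by
  obtain ⟨V, hV, hVi⟩ := hΨi
  have hT : Tendsto Ψ (𝓝 0) (𝓝 z₀) := by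
    have := hΨc.self_of_nhds
    rwa [ContinuousAt, hΨ0] at this
  have hev := (((hΨc.and (hT.eventually hf)).and (hT.eventually hU)).and
    (eventually_mem_set.2 hV)).and hline
  obtain ⟨δ, hδ, hball⟩ := Metric.eventually_nhds_iff.1 hev
  have hmem : ∀ k, ∀ s ∈ Icc (0 : ℝ) 1, dist (((δ / 2 * s : ℝ) : ℂ) * e k) 0 < δ := by
    intro k s hs
    rw [dist_zero_right, norm_mul, he, mul_one, Complex.norm_real, Real.norm_eq_abs, abs_of_nonneg
      (by have := hs.1; positivity)]
    nlinarith [hs.2]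
  set q : Fin 3 → ℝ → ℝ := fun k s => (u * f (Ψ (((δ / 2 * s : ℝ) : ℂ) * e k))).im with hq
  have hq_inj : ∀ j k, ∀ s ∈ Icc (0 : ℝ) 1, ∀ t ∈ Icc (0 : ℝ) 1, q j s = q k t →
      (((δ / 2 * s : ℝ) : ℂ) * e j) = (((δ / 2 * t : ℝ) : ℂ) * e k) := by
    intro j k s hs t ht hst
    obtain ⟨⟨⟨-, h1⟩, h2⟩, h3⟩ := hball (hmem j s hs)
    obtain ⟨⟨⟨-, h1'⟩, h2'⟩, h3'⟩ := hball (hmem k t ht)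
    have hre := (h3 j _ rfl).trans (h3' k _ rfl).symm
    exact hVi h2 h2' (hinj h1 h1' (mul_left_cancel₀ hu (Complex.ext hre hst)))
  refine not_three_arcs_into_line (q := q) (c := (u * f z₀).im) ?_ ?_ ?_ ?_
  · intro k s hs
    obtain ⟨⟨⟨⟨h1, h2⟩, -⟩, -⟩, -⟩ := hball (hmem k s hs)
    refine ContinuousAt.continuousWithinAt ?_
    refine Complex.continuous_im.continuousAt.comp (continuousAt_const.mul ?_)
    refine ContinuousAt.comp (g := f) h2 (ContinuousAt.comp (g := Ψ) h1 ?_)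
    fun_prop
  · intro k; simp [hq, hΨ0]
  · intro k hk
    have h0 : q k 0 = (u * f z₀).im := by simp [hq, hΨ0]
    have := hq_inj k k 1 (by simp) 0 (by simp) (hk.trans h0.symm)
    have he0 : e k ≠ 0 := by intro h; have := he k; rw [h] at this; simp at this
    simp [hδ.ne', he0] at this
  · intro j k s hs t ht hst
    have h := hq_inj j k s (Ioc_subset_Icc_self hs) t (Ioc_subset_Icc_self ht) hst
    have hn := congrArg norm h
    rw [norm_mul, norm_mul, he, he, mul_one, mul_one, Complex.norm_real, Complex.norm_real,
      Real.norm_eq_abs, Real.norm_eq_abs, abs_of_nonneg (by have := hs.1; positivity),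
      abs_of_nonneg (by have := ht.1; positivity)] at hn
    rw [hn] at h
    refine hei (mul_left_cancel₀ ?_ h)
    have := ht.1
    norm_cast
    positivity

/-- Among the `2 n ≥ 4` rays on which `x ^ n` is purely imaginary there are three distinct ones. -/
lemma exists_rays {n : ℕ} (hn : 2 ≤ n) :
    ∃ e : Fin 3 → ℂ, (∀ k, ‖e k‖ = 1) ∧ Function.Injective e ∧ ∀ k, (e k ^ n).re = 0 := by
  have hn0 : (n : ℝ) ≠ 0 := by positivity
  refine ⟨fun k => Complex.exp (((2 * (k : ℕ) + 1) * Real.pi / (2 * n) : ℝ) * I), ?_, ?_, ?_⟩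
  · intro k; exact Complex.norm_exp_ofReal_mul_I _
  · intro j k hjk
    simp only at hjk
    rw [Complex.exp_eq_exp_iff_exists_int] at hjk
    obtain ⟨m, hm⟩ := hjk
    have hm' : ((2 * (j : ℕ) + 1) * Real.pi / (2 * n) : ℝ) =
        (2 * (k : ℕ) + 1) * Real.pi / (2 * n) + m * (2 * Real.pi) := by
      apply Complex.ofReal_injective
      apply mul_right_cancel₀ Complex.I_ne_zero
      rw [hm]
      push_cast
      ring
    have h3 : ((2 * (j : ℕ) + 1 : ℝ)) = (2 * (k : ℕ) + 1) + m * (4 * n) := by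
      have hpi := Real.pi_ne_zero
      field_simp at hm'
      linarith
    have h4 : ((2 * (j : ℕ) + 1 : ℤ)) = (2 * (k : ℕ) + 1) + m * (4 * n) := by exact_mod_cast h3
    have hj := j.2
    have hk := k.2
    have hm0 : m = 0 := by
      by_contra hm0
      rcases lt_or_gt_of_ne hm0 with h | h
      · have : m * (4 * n) ≤ (-1) * (4 * 2) := by nlinarith
        omega
      · have : 1 * (4 * 2) ≤ m * (4 * n) := by nlinarith
        omega
    rw [hm0] at h4
    apply Fin.ext
    omega
  · intro k
    rw [← Complex.exp_nat_mul]
    have : (n : ℂ) * ((((2 * (k : ℕ) + 1) * Real.pi / (2 * n) : ℝ) : ℂ) * I) =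
        (((k : ℕ) * Real.pi + Real.pi / 2 : ℝ) : ℂ) * I := by
      have : (n : ℂ) ≠ 0 := by exact_mod_cast hn0
      push_cast
      field_simp
    rw [this, Complex.exp_ofReal_mul_I_re, Real.cos_add_pi_div_two, Real.sin_nat_mul_pi, neg_zero]

/-- **Lewy's theorem**: the Jacobian of a locally injective harmonic map does not vanish. If
`|h'| = |g'|` at `z₀`, then `Re (u f)` is the real part of an analytic function with a critical point
at `z₀` for some `u ≠ 0`, so its level set through `z₀` contains three arcs. -/
theorem norm_deriv_ne_of_injOn {h g : ℂ → ℂ} {z₀ : ℂ} (hh : AnalyticAt ℂ h z₀)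
    (hg : AnalyticAt ℂ g z₀) {U : Set ℂ} (hU : U ∈ 𝓝 z₀)
    (hinj : InjOn (fun z => h z + conj (g z)) U) : ‖deriv h z₀‖ ≠ ‖deriv g z₀‖ := by
  intro heq
  obtain ⟨u, hu, hFu⟩ : ∃ u : ℂ, u ≠ 0 ∧ u * deriv h z₀ + conj u * deriv g z₀ = 0 := by
    by_cases hA : deriv h z₀ = 0
    · have hB : deriv g z₀ = 0 := by rw [hA, norm_zero] at heq; exact norm_eq_zero.1 heq.symm
      exact ⟨1, one_ne_zero, by simp [hA, hB]⟩
    · obtain ⟨u, hu⟩ := IsAlgClosed.exists_pow_nat_eq (-deriv g z₀ / deriv h z₀) two_pos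
      have hnu : ‖u‖ = 1 := by
        have h1 := congrArg norm hu
        rw [norm_pow, norm_div, norm_neg, heq, div_self (by rw [← heq]; simpa using hA)] at h1
        exact (pow_eq_one_iff_of_nonneg (norm_nonneg _) two_ne_zero).1 h1
      have hu0 : u ≠ 0 := by intro h; rw [h] at hnu; simp at hnu
      refine ⟨u, hu0, ?_⟩
      have h2 : u ^ 2 * deriv h z₀ = - deriv g z₀ := by rw [hu]; field_simp
      have h3 : conj u * u = 1 := by
        rw [mul_comm, Complex.mul_conj, Complex.normSq_eq_norm_sq, hnu]; simp
      linear_combination conj u * h2 - u * deriv h z₀ * h3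
  set F : ℂ → ℂ := fun z => u * h z + conj u * g z with hF
  have hFan : AnalyticAt ℂ F z₀ := (analyticAt_const.mul hh).add (analyticAt_const.mul hg)
  have hF' : deriv F z₀ = 0 := by
    have := (hh.differentiableAt.hasDerivAt.const_mul u).add
      (hg.differentiableAt.hasDerivAt.const_mul (conj u))
    rw [← hFu]
    exact this.deriv
  have hre : ∀ z, (u * (h z + conj (g z))).re = (F z).re := by
    intro z
    simp [hF]
    ring
  have hfc : ∀ᶠ z in 𝓝 z₀, ContinuousAt (fun z => h z + conj (g z)) z := by
    filter_upwards [hh.eventually_analyticAt, hg.eventually_analyticAt] with z h1 h2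
    exact h1.continuousAt.add (Complex.continuous_conj.continuousAt.comp h2.continuousAt)
  by_cases hnc : ∀ᶠ z in 𝓝 z₀, F z = F z₀
  · obtain ⟨e, he, hei, -⟩ := exists_rays le_rfl
    have hT : Tendsto (fun x : ℂ => z₀ + x) (𝓝 0) (𝓝 z₀) := by
      have : Continuous (fun x : ℂ => z₀ + x) := by fun_prop
      simpa using this.tendsto 0
    refine not_injOn_of_three_rays (f := fun z => h z + conj (g z)) (Ψ := fun x => z₀ + x) hu hfc hU
      hinj (by simp)
      (Eventually.of_forall fun x => by fun_prop)
      ⟨univ, univ_mem, (add_right_injective z₀).injOn⟩ e he hei ?_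
    filter_upwards [hT.eventually hnc] with x hx k s _
    rw [hre, hre, hx]
  · obtain ⟨n, hn, Ψ, hΨ0, hΨc, hΨi, hΨF⟩ := exists_pow_coordinate hFan hnc hF'
    obtain ⟨e, he, hei, hen⟩ := exists_rays hn
    refine not_injOn_of_three_rays (f := fun z => h z + conj (g z)) hu hfc hU hinj hΨ0 hΨc hΨi e he
      hei ?_
    filter_upwards [hΨF] with x hx k s hxs
    rw [hre, hre, hx, hxs, mul_pow, ← Complex.ofReal_pow, Complex.add_re, Complex.re_ofReal_mul, hen,
      mul_zero, add_zero]

/-! ### Local behaviour of sense-preserving maps -/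

lemma map_nhds_add_conj {h g : ℂ → ℂ} {z : ℂ} (hh : AnalyticAt ℂ h z) (hg : AnalyticAt ℂ g z)
    (hJ : ‖deriv g z‖ < ‖deriv h z‖) :
    map (fun w => h w + conj (g w)) (𝓝 z) = 𝓝 (h z + conj (g z)) := by
  obtain ⟨T, hT⟩ := exists_equiv_harmDeriv hJ
  have h1 := hasStrictFDerivAt_add_conj hh.hasStrictDerivAt hg.hasStrictDerivAt
  rw [← hT] at h1
  exact h1.map_nhds_eq_of_equiv

/-- A differentiable local inverse `σ` of a sense-preserving harmonic map, with derivative `T`. -/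
lemma exists_local_section {h g : ℂ → ℂ} {z : ℂ} (hh : AnalyticAt ℂ h z) (hg : AnalyticAt ℂ g z)
    (hJ : ‖deriv g z‖ < ‖deriv h z‖) :
    ∃ (σ : ℂ → ℂ) (T : ℂ →L[ℝ] ℂ), σ (h z + conj (g z)) = z ∧
      (∀ v, harmDeriv (deriv h z) (deriv g z) (T v) = v) ∧
      HasFDerivAt σ T (h z + conj (g z)) ∧
      (∀ᶠ w in 𝓝 (h z + conj (g z)), h (σ w) + conj (g (σ w)) = w) := by
  obtain ⟨T, hT⟩ := exists_equiv_harmDeriv hJ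
  have h1 := hasStrictFDerivAt_add_conj hh.hasStrictDerivAt hg.hasStrictDerivAt
  rw [← hT] at h1
  refine ⟨h1.localInverse _ _ _, T.symm, h1.localInverse_apply_image, ?_,
    h1.to_localInverse.hasFDerivAt, h1.eventually_right_inverse⟩
  intro v
  rw [← hT]
  simp

lemma exists_injOn_nhds {h g : ℂ → ℂ} {z : ℂ} (hh : AnalyticAt ℂ h z) (hg : AnalyticAt ℂ g z)
    (hJ : ‖deriv g z‖ < ‖deriv h z‖) :
    ∃ V : Set ℂ, IsOpen V ∧ z ∈ V ∧ InjOn (fun w => h w + conj (g w)) V := by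
  obtain ⟨T, hT⟩ := exists_equiv_harmDeriv hJ
  have h1 := hasStrictFDerivAt_add_conj hh.hasStrictDerivAt hg.hasStrictDerivAt
  rw [← hT] at h1
  have h2 := (h1.toOpenPartialHomeomorph _).injOn
  rw [h1.toOpenPartialHomeomorph_coe] at h2
  exact ⟨_, (h1.toOpenPartialHomeomorph _).open_source, h1.mem_toOpenPartialHomeomorph_source, h2⟩

lemma isOpen_image_add_conj {h g : ℂ → ℂ} {U : Set ℂ} (hU : IsOpen U)
    (hh : ∀ z ∈ U, AnalyticAt ℂ h z) (hg : ∀ z ∈ U, AnalyticAt ℂ g z)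
    (hJ : ∀ z ∈ U, ‖deriv g z‖ < ‖deriv h z‖) :
    IsOpen ((fun w => h w + conj (g w)) '' U) := by
  rw [isOpen_iff_mem_nhds]
  rintro _ ⟨z, hz, rfl⟩
  rw [← map_nhds_add_conj (hh z hz) (hg z hz) (hJ z hz)]
  exact image_mem_map (hU.mem_nhds hz)

lemma continuousAt_add_conj {h g : ℂ → ℂ} {z : ℂ} (hh : AnalyticAt ℂ h z)
    (hg : AnalyticAt ℂ g z) : ContinuousAt (fun w => h w + conj (g w)) z :=
  hh.continuousAt.add (Complex.continuous_conj.continuousAt.comp hg.continuousAt)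

lemma norm_deriv_lt_of_locallyInjective {h g : ℂ → ℂ} (hh : AnalyticOnNhd ℂ h (ball 0 1))
    (hg : AnalyticOnNhd ℂ g (ball 0 1))
    (hloc : IsLocallyUnivalent (fun z => h z + conj (g z)))
    (h0 : ‖deriv g 0‖ < ‖deriv h 0‖) : ∀ z ∈ ball (0 : ℂ) 1, ‖deriv g z‖ < ‖deriv h z‖ := by
  intro z hz
  by_contra hcon
  obtain ⟨w, hw, hweq⟩ := (convex_ball (0 : ℂ) 1).isPreconnected.intermediate_value₂ hz
    (mem_ball_self one_pos) hh.deriv.continuousOn.norm hg.deriv.continuousOn.norm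
    (not_lt.1 hcon) h0.le
  obtain ⟨U, hU, hinj⟩ := hloc w hw
  exact norm_deriv_ne_of_injOn (hh w hw) (hg w hw) hU hinj hweq

/-- The canonical decomposition is determined by `f`: its derivatives are the Wirtinger derivatives
of `f`. -/
lemma deriv_eq_of_decomp {f h g h₁ g₁ : ℂ → ℂ} (hd : IsNormalizedDecomp f h g)
    (hd₁ : IsNormalizedDecomp f h₁ g₁) {z : ℂ} (hz : z ∈ ball (0 : ℂ) 1) :
    deriv h z = deriv h₁ z ∧ deriv g z = deriv g₁ z := by
  have key : ∀ {h g : ℂ → ℂ}, IsNormalizedDecomp f h g →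
      HasFDerivAt f (harmDeriv (deriv h z) (deriv g z)) z := by
    intro h g hd
    refine (hasStrictFDerivAt_add_conj (hd.analytic_h z hz).hasStrictDerivAt
      (hd.analytic_g z hz).hasStrictDerivAt).hasFDerivAt.congr_of_eventuallyEq ?_
    filter_upwards [isOpen_ball.mem_nhds hz] with w hw using hd.eq_add_conj w hw
  have h1 := (key hd).unique (key hd₁)
  have e1 := congrArg (fun T : ℂ →L[ℝ] ℂ => T 1) h1
  have e2 := congrArg (fun T : ℂ →L[ℝ] ℂ => T I) h1
  simp only [harmDeriv_apply, mul_one, map_mul, Complex.conj_I] at e1 e2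
  have e3 : deriv h z - conj (deriv g z) = deriv h₁ z - conj (deriv g₁ z) := by
    apply mul_right_cancel₀ Complex.I_ne_zero
    linear_combination e2
  refine ⟨by linear_combination e1 / 2 + e3 / 2, ?_⟩
  have e4 : conj (deriv g z) = conj (deriv g₁ z) := by linear_combination e1 / 2 - e3 / 2
  exact (starRingEnd ℂ).injective e4

/-! ### Extrema on a disk -/

/-- If `φ` is maximal at a boundary point `z` of a disk, its derivative is nonpositive in the inward
directions. -/
lemma apply_nonpos_of_le_on_ball {φ : ℂ → ℝ} {L : ℂ →L[ℝ] ℝ} {a z v : ℂ}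
    (hφ : HasFDerivAt φ L z) (hmax : ∀ w ∈ ball a ‖z - a‖, φ w ≤ φ z)
    (hv : (conj (z - a) * v).re < 0) : L v ≤ 0 := by
  have hd : HasDerivAt (fun s : ℝ => φ (z + s • v)) (L v) 0 := by
    have h1 : HasDerivAt (fun s : ℝ => z + s • v) v 0 := by
      simpa using ((hasDerivAt_id (0 : ℝ)).smul_const v).const_add z
    have h2 : HasFDerivAt φ L (z + (0 : ℝ) • v) := by simpa using hφ
    exact h2.comp_hasDerivAt 0 h1
  refine le_of_tendsto hd.tendsto_slope_zero_right ?_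
  have hsmall : ∀ᶠ s in 𝓝[>] (0 : ℝ), 2 * (conj (z - a) * v).re + s * ‖v‖ ^ 2 < 0 := by
    have : Tendsto (fun s : ℝ => 2 * (conj (z - a) * v).re + s * ‖v‖ ^ 2) (𝓝[>] 0)
        (𝓝 (2 * (conj (z - a) * v).re + 0 * ‖v‖ ^ 2)) := by
      refine Tendsto.mono_left ?_ nhdsWithin_le_nhds
      exact Continuous.tendsto (by fun_prop) 0
    refine this.eventually_lt_const ?_
    linarith
  filter_upwards [hsmall, self_mem_nhdsWithin] with s hs hs0
  have hs0' : 0 < s := hs0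
  have hmem : z + s • v ∈ ball a ‖z - a‖ := by
    rw [mem_ball, dist_eq_norm]
    refine lt_of_pow_lt_pow_left₀ 2 (norm_nonneg _) ?_
    have : z + s • v - a = (z - a) + (s : ℂ) * v := by simp; ring
    rw [this, ← Complex.normSq_eq_norm_sq, ← Complex.normSq_eq_norm_sq, Complex.normSq_add]
    have h1 : ((z - a) * conj ((s : ℂ) * v)).re = s * (conj (z - a) * v).re := by
      simp; ring
    have h2 : Complex.normSq ((s : ℂ) * v) = s ^ 2 * ‖v‖ ^ 2 := by
      rw [Complex.normSq_mul, Complex.normSq_ofReal, Complex.normSq_eq_norm_sq]; ring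
    rw [h1, h2]
    nlinarith
  have := hmax _ hmem
  simp only [zero_add, zero_smul, add_zero, smul_eq_mul]
  exact mul_nonpos_of_nonneg_of_nonpos (by positivity) (by linarith)

/-- If `φ` is maximal at a boundary point `z` of a disk, a direction in which `φ` increases points
strictly outwards. -/
lemma re_pos_of_le_on_ball {φ : ℂ → ℝ} {L : ℂ →L[ℝ] ℝ} {a z v : ℂ} (hza : z ≠ a)
    (hφ : HasFDerivAt φ L z) (hmax : ∀ w ∈ ball a ‖z - a‖, φ w ≤ φ z)
    (hv : 0 < L v) : 0 < (conj (z - a) * v).re := by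
  by_contra hcon
  -- a small perturbation of `v` towards the centre still increases `φ`, yet points inwards
  obtain ⟨η, hη, hη'⟩ : ∃ η : ℝ, 0 < η ∧ 0 < L v - η * L (z - a) := by
    refine ⟨L v / (2 * (|L (z - a)| + 1)), by positivity, ?_⟩
    have h1 := le_abs_self (L (z - a))
    have h2 : L v / (2 * (|L (z - a)| + 1)) * L (z - a) ≤ L v / 2 := by
      rw [div_mul_eq_mul_div, div_le_div_iff₀ (by positivity) two_pos]
      nlinarith [abs_nonneg (L (z - a))]
    linarith
  have hn : 0 < Complex.normSq (z - a) := Complex.normSq_pos.2 (sub_ne_zero.2 hza)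
  have h3 : (conj (z - a) * (v - η • (z - a))).re < 0 := by
    have : (conj (z - a) * (v - η • (z - a))).re
        = (conj (z - a) * v).re - η * Complex.normSq (z - a) := by
      simp [Complex.normSq_apply]; ring
    rw [this]
    nlinarith
  have := apply_nonpos_of_le_on_ball hφ hmax h3
  rw [map_sub, map_smul, smul_eq_mul] at this
  linarith

/-- If `ℓ ∘ f` is maximal over the disk `|w| < |z|` at the boundary point `z`, then the points
`f z - s u`, with `ℓ u > 0` and `s > 0` small, have preimages in that disk tending to `z`. -/
lemma eventually_exists_preimage_in_ball {h g : ℂ → ℂ} {z u : ℂ} (ℓ : ℂ →L[ℝ] ℝ) (hz : z ≠ 0)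
    (hh : AnalyticAt ℂ h z) (hg : AnalyticAt ℂ g z) (hJ : ‖deriv g z‖ < ‖deriv h z‖)
    (hmax : ∀ w ∈ ball (0 : ℂ) ‖z‖, ℓ (h w + conj (g w)) ≤ ℓ (h z + conj (g z)))
    (hu : 0 < ℓ u) :
    ∃ γ : ℝ → ℂ, Tendsto γ (𝓝[>] 0) (𝓝 z) ∧ ∀ᶠ s in 𝓝[>] (0 : ℝ), ‖γ s‖ < ‖z‖ ∧
      h (γ s) + conj (g (γ s)) = h z + conj (g z) - s • u := by
  obtain ⟨σ, T, hσ, hT, hσT, hσr⟩ := exists_local_section hh hg hJ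
  have hpos : 0 < (conj (z - 0) * T u).re := by
    refine re_pos_of_le_on_ball hz (φ := fun w => ℓ (h w + conj (g w)))
      (ℓ.hasFDerivAt.comp z (hasStrictFDerivAt_add_conj hh.hasStrictDerivAt
        hg.hasStrictDerivAt).hasFDerivAt) (by simpa using hmax) ?_
    rw [ContinuousLinearMap.comp_apply, hT]
    exact hu
  rw [sub_zero] at hpos
  set w := h z + conj (g z) with hw
  have hline : HasDerivAt (fun s : ℝ => w - s • u) (-u) 0 := by
    simpa using ((hasDerivAt_id (0 : ℝ)).smul_const u).const_sub w
  have hσ0 : HasFDerivAt σ T (w - (0 : ℝ) • u) := by simpa using hσT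
  have hγ : HasDerivAt (fun s : ℝ => σ (w - s • u)) (T (-u)) 0 := hσ0.comp_hasDerivAt 0 hline
  have hγ0 : σ (w - (0 : ℝ) • u) = z := by simp [hσ]
  refine ⟨fun s => σ (w - s • u), ?_, ?_⟩
  · have := hγ.continuousAt.tendsto
    simp only [hγ0] at this
    exact this.mono_left nhdsWithin_le_nhds
  · have hnorm := hγ.norm_sq
    simp only [hγ0] at hnorm
    have hneg : 2 * inner ℝ z (T (-u)) < 0 := by
      rw [map_neg, inner_neg_right, Complex.inner]
      rw [mul_comm] at hpos
      linarith
    have hev : ∀ᶠ s in 𝓝[>] (0 : ℝ), w - s • u ∈ {y | h (σ y) + conj (g (σ y)) = y} := by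
      have : Tendsto (fun s : ℝ => w - s • u) (𝓝[>] 0) (𝓝 w) := by
        have := hline.continuousAt.tendsto
        simp only [zero_smul, sub_zero] at this
        exact this.mono_left nhdsWithin_le_nhds
      exact this.eventually hσr
    filter_upwards [hnorm.tendsto_slope_zero_right.eventually_lt_const hneg, self_mem_nhdsWithin,
      hev] with s hs hs0 hs1
    refine ⟨?_, hs1⟩
    have hs0' : 0 < s := hs0
    simp only [zero_add, smul_eq_mul, hγ0] at hs
    refine lt_of_pow_lt_pow_left₀ 2 (norm_nonneg _) ?_
    have : s⁻¹ * (‖σ (w - s • u)‖ ^ 2 - ‖z‖ ^ 2) < 0 := hs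
    have h5 := (mul_neg_iff.1 this).resolve_right (fun h => absurd h.1 (not_lt.2 (by positivity)))
    linarith [h5.2]

/-! ### Global injectivity -/

/-- A sense-preserving harmonic map with convex images of all disks `|z| < r`, `r < 1`, is injective
in the unit disk. -/
theorem injOn_of_convex_images {h g : ℂ → ℂ} (hh : AnalyticOnNhd ℂ h (ball 0 1))
    (hg : AnalyticOnNhd ℂ g (ball 0 1)) (hJ : ∀ z ∈ ball (0 : ℂ) 1, ‖deriv g z‖ < ‖deriv h z‖)
    (hconv : ∀ r ∈ Ioo (0 : ℝ) 1, Convex ℝ ((fun z => h z + conj (g z)) '' ball 0 r)) :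
    InjOn (fun z => h z + conj (g z)) (ball 0 1) := by
  set F : ℂ → ℂ := fun z => h z + conj (g z) with hF
  have hFc : ∀ z ∈ ball (0 : ℂ) 1, ContinuousAt F z := fun z hz =>
    continuousAt_add_conj (hh z hz) (hg z hz)
  intro x₀ hx₀ y₀ hy₀ hxy₀
  by_contra hne₀
  set R := max ‖x₀‖ ‖y₀‖ with hR
  have hR1 : R < 1 := max_lt (by simpa using hx₀) (by simpa using hy₀)
  have hsub : closedBall (0 : ℂ) R ⊆ ball 0 1 := closedBall_subset_ball hR1
  choose! V hVo hVm hVi using fun z (hz : z ∈ ball (0 : ℂ) 1) =>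
    exists_injOn_nhds (hh z hz) (hg z hz) (hJ z hz)
  -- `Q \ W` is the set of pairs of distinct points of the closed disk with the same image; it is
  -- compact because `f` is locally injective
  set K : Set (ℂ × ℂ) := closedBall 0 R ×ˢ closedBall 0 R with hK
  have hKc : IsCompact K := (isCompact_closedBall 0 R).prod (isCompact_closedBall 0 R)
  set Q : Set (ℂ × ℂ) := K ∩ (fun p => F p.1 - F p.2) ⁻¹' {0} with hQ
  have hQc : IsCompact Q := by
    refine hKc.of_isClosed_subset ?_ inter_subset_left
    refine ContinuousOn.preimage_isClosed_of_isClosed ?_ hKc.isClosed isClosed_singleton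
    rintro ⟨x, y⟩ ⟨hx, hy⟩
    refine ContinuousAt.continuousWithinAt ?_
    exact (ContinuousAt.comp (g := F) (f := Prod.fst) (x := (x, y)) (hFc x (hsub hx))
      continuousAt_fst).sub
      (ContinuousAt.comp (g := F) (f := Prod.snd) (x := (x, y)) (hFc y (hsub hy)) continuousAt_snd)
  set W : Set (ℂ × ℂ) := ⋃ z ∈ ball (0 : ℂ) 1, V z ×ˢ V z with hW
  have hWo : IsOpen W := isOpen_biUnion fun z hz => (hVo z hz).prod (hVo z hz)
  have hPmem : ∀ p : ℂ × ℂ, p ∈ Q \ W ↔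
      ‖p.1‖ ≤ R ∧ ‖p.2‖ ≤ R ∧ p.1 ≠ p.2 ∧ F p.1 = F p.2 := by
    rintro ⟨x, y⟩
    simp only [hQ, hK, hW, Set.mem_sdiff, mem_inter_iff, mem_prod, mem_closedBall, dist_zero_right,
      mem_preimage, mem_singleton_iff, sub_eq_zero, mem_iUnion, not_exists]
    constructor
    · rintro ⟨⟨⟨hx, hy⟩, he⟩, hnot⟩
      refine ⟨hx, hy, ?_, he⟩
      rintro rfl
      have hx1 : x ∈ ball (0 : ℂ) 1 := hsub (by simpa using hx)
      exact hnot x hx1 ⟨hVm x hx1, hVm x hx1⟩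
    · rintro ⟨hx, hy, hne, he⟩
      exact ⟨⟨⟨hx, hy⟩, he⟩, fun z hz hm => hne (hVi z hz hm.1 hm.2 he)⟩
  obtain ⟨⟨z₁, z₂⟩, hz, hmin⟩ := (hQc.diff hWo).exists_isMinOn
    ⟨(x₀, y₀), (hPmem _).2 ⟨le_max_left _ _, le_max_right _ _, hne₀, hxy₀⟩⟩
    (f := fun p : ℂ × ℂ => max ‖p.1‖ ‖p.2‖) (by fun_prop)
  obtain ⟨hz₁R, hz₂R, hzne, hzF⟩ := (hPmem _).1 hz
  simp only at hz₁R hz₂R hzne hzF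
  set r := max ‖z₁‖ ‖z₂‖ with hr
  have hrR : r ≤ R := max_le hz₁R hz₂R
  have hrD : ∀ x : ℂ, ‖x‖ ≤ r → x ∈ ball (0 : ℂ) 1 := fun x hx => hsub (by
    simpa using hx.trans hrR)
  -- minimality: `f` is injective in the open disk of radius `r`
  have hM : ∀ x y, x ≠ y → F x = F y → ‖x‖ < r → ‖y‖ < r → False := by
    intro x y hne he hx hy
    have := isMinOn_iff.1 hmin (x, y) ((hPmem _).2 ⟨hx.le.trans hrR, hy.le.trans hrR, hne, he⟩)
    exact absurd this (not_le.2 (max_lt hx hy))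
  -- as `f` is open, a coincidence between `|x| = r` and `|y| < r` can be moved inside
  have hM2 : ∀ x y, F x = F y → ‖x‖ = r → ‖y‖ < r → False := by
    intro x y he hx hy
    have hne : x ≠ y := by rintro rfl; linarith
    obtain ⟨A, B, hA, hB, hxA, hyB, hAB⟩ := t2_separation hne
    have hyD := hrD y hy.le
    have h1 : F '' (B ∩ ball 0 r) ∈ 𝓝 (F x) := by
      rw [he, ← map_nhds_add_conj (hh y hyD) (hg y hyD) (hJ y hyD)]
      exact image_mem_map (inter_mem (hB.mem_nhds hyB) (isOpen_ball.mem_nhds (by simpa using hy)))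
    have h2 := (hFc x (hrD x hx.le)) h1
    have hr0 : r ≠ 0 := ((norm_nonneg y).trans_lt hy).ne'
    have hxc : x ∈ closure (ball (0 : ℂ) r) := by
      rw [closure_ball _ hr0]; simpa using hx.le
    obtain ⟨x', ⟨hx'1, hx'2⟩, hx'3⟩ :=
      mem_closure_iff_nhds.1 hxc _ (inter_mem h2 (hA.mem_nhds hxA))
    obtain ⟨y', ⟨hy'1, hy'2⟩, hy'3⟩ := hx'1
    refine hM x' y' ?_ hy'3.symm (by simpa using hx'3) (by simpa using hy'2)
    rintro rfl
    exact disjoint_left.1 hAB hx'2 hy'1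
  have hz₁ : ‖z₁‖ = r := by
    refine le_antisymm (le_max_left _ _) (not_lt.1 fun hlt => ?_)
    have h2 : ‖z₂‖ = r := by
      rcases max_choice ‖z₁‖ ‖z₂‖ with h | h
      · exact absurd h.symm hlt.ne
      · exact h.symm
    exact hM2 z₂ z₁ hzF.symm h2 hlt
  have hz₂ : ‖z₂‖ = r := by
    refine le_antisymm (le_max_right _ _) (not_lt.1 fun hlt => ?_)
    exact hM2 z₁ z₂ hzF hz₁ hlt
  have hr0 : 0 < r := by
    refine lt_of_le_of_ne ((norm_nonneg z₁).trans hz₁.le) fun h0 => hzne ?_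
    rw [norm_eq_zero.1 (hz₁.trans h0.symm), norm_eq_zero.1 (hz₂.trans h0.symm)]
  have hz₁0 : z₁ ≠ 0 := norm_pos_iff.1 (hz₁ ▸ hr0)
  have hz₂0 : z₂ ≠ 0 := norm_pos_iff.1 (hz₂ ▸ hr0)
  have hbD : ball (0 : ℂ) r ⊆ ball 0 1 := fun x hx => hrD x (mem_ball_zero_iff.1 hx).le
  have hopen : IsOpen (F '' ball 0 r) := isOpen_image_add_conj isOpen_ball
    (fun z hz => hh z (hbD hz)) (fun z hz => hg z (hbD hz)) (fun z hz => hJ z (hbD hz))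
  -- the common image is a boundary point of the convex image, so it has a supporting line
  have hw : F z₁ ∉ F '' ball 0 r := by
    rintro ⟨y, hy, he⟩
    exact hM2 z₁ y he.symm hz₁ (by simpa using hy)
  obtain ⟨ℓ, hℓ⟩ := geometric_hahn_banach_open_point (hconv r ⟨hr0, hrR.trans_lt hR1⟩) hopen hw
  have hu : 0 < ℓ (F z₁ - F 0) := by
    rw [map_sub]
    exact sub_pos.2 (hℓ _ ⟨0, mem_ball_self hr0, rfl⟩)
  have hz₁D := hrD z₁ hz₁.le
  have hz₂D := hrD z₂ hz₂.le
  obtain ⟨γ₁, hγ₁, hγ₁'⟩ := eventually_exists_preimage_in_ball ℓ hz₁0 (hh z₁ hz₁D) (hg z₁ hz₁D)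
    (hJ z₁ hz₁D) (fun w hw => (hℓ _ ⟨w, by rwa [hz₁] at hw, rfl⟩).le) hu
  obtain ⟨γ₂, hγ₂, hγ₂'⟩ := eventually_exists_preimage_in_ball ℓ hz₂0 (hh z₂ hz₂D) (hg z₂ hz₂D)
    (hJ z₂ hz₂D) (fun w hw => by
      have := hℓ _ ⟨w, by rwa [hz₂] at hw, rfl⟩
      rw [hzF] at this
      exact this.le) hu
  obtain ⟨s, ⟨h1, h1'⟩, ⟨h2, h2'⟩, h3⟩ := (hγ₁'.and (hγ₂'.and
    ((hγ₁.prodMk_nhds hγ₂).eventually (isOpen_ne_fun continuous_fst continuous_snd |>.mem_nhds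
      (show (z₁, z₂) ∈ {p : ℂ × ℂ | p.1 ≠ p.2} from hzne))))).exists
  refine hM (γ₁ s) (γ₂ s) h3 ?_ (h1.trans_eq hz₁) (h2.trans_eq hz₂)
  show h (γ₁ s) + conj (g (γ₁ s)) = h (γ₂ s) + conj (g (γ₂ s))
  rw [h1', h2']
  have : h z₁ + conj (g z₁) = h z₂ + conj (g z₂) := hzF
  rw [this]

/-! ### Absolutely convex pairs -/

/-- The analytic and co-analytic parts of a sense-preserving injective harmonic map of the unit disk
that maps all disks `|z - a| < r`, `r < 1 - |a|`, onto convex sets. There is no normalization at `0`,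
which makes the notion invariant under `AbsConvexPair.affine`. -/
structure AbsConvexPair (h g : ℂ → ℂ) : Prop where
  analytic_left : AnalyticOnNhd ℂ h (ball 0 1)
  analytic_right : AnalyticOnNhd ℂ g (ball 0 1)
  norm_deriv_lt : ∀ z ∈ ball (0 : ℂ) 1, ‖deriv g z‖ < ‖deriv h z‖
  injOn : InjOn (fun z => h z + conj (g z)) (ball 0 1)
  convex_image : ∀ a ∈ ball (0 : ℂ) 1, ∀ r ∈ Ioo (0 : ℝ) (1 - ‖a‖),
    Convex ℝ ((fun z => h z + conj (g z)) '' ball a r)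

lemma AbsConvexPair.of_mem_classAK {f h g : ℂ → ℂ} (hf : f ∈ classAK)
    (hd : IsNormalizedDecomp f h g) (hg0 : deriv g 0 = 0) : AbsConvexPair h g := by
  obtain ⟨-, hloc, hconv⟩ := hf
  have heq : EqOn f (fun z => h z + conj (g z)) (ball 0 1) := hd.eq_add_conj
  have hloc' : IsLocallyUnivalent (fun z => h z + conj (g z)) := by
    intro z hz
    obtain ⟨U, hU, hi⟩ := hloc z hz
    refine ⟨U ∩ ball 0 1, inter_mem hU (isOpen_ball.mem_nhds hz), ?_⟩
    exact (hi.mono inter_subset_left).congr (heq.mono inter_subset_right)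
  have hconv' : ∀ a ∈ ball (0 : ℂ) 1, ∀ r ∈ Ioo (0 : ℝ) (1 - ‖a‖),
      Convex ℝ ((fun z => h z + conj (g z)) '' ball a r) := by
    intro a ha r hr
    have hsub : ball a r ⊆ ball (0 : ℂ) 1 := ball_subset_ball' (by
      rw [dist_zero_right]; linarith [hr.2])
    rw [← (heq.mono hsub).image_eq]
    exact hconv a ha r hr
  have hJ := norm_deriv_lt_of_locallyInjective hd.analytic_h hd.analytic_g hloc'
    (by rw [hg0, hd.deriv_h_zero]; simp)
  refine ⟨hd.analytic_h, hd.analytic_g, hJ, ?_, hconv'⟩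
  exact injOn_of_convex_images hd.analytic_h hd.analytic_g hJ fun r hr =>
    hconv' 0 (mem_ball_self one_pos) r (by simpa using hr)

/-- Invariance under `f ↦ f + c conj f`, which is the invertible real-linear map `w ↦ w + c conj w`
after `f`. -/
lemma AbsConvexPair.affine {h g : ℂ → ℂ} (hp : AbsConvexPair h g) {c : ℂ} (hc : ‖c‖ < 1) :
    AbsConvexPair (fun z => h z + c * g z) (fun z => g z + conj c * h z) := by
  have himg : ∀ z, h z + c * g z + conj (g z + conj c * h z) =
      harmDeriv 1 (conj c) (h z + conj (g z)) := by
    intro z; simp; ring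
  have hinj : Function.Injective (harmDeriv 1 (conj c)) := by
    obtain ⟨T, hT⟩ := exists_equiv_harmDeriv (A := 1) (B := conj c) (by simpa using hc)
    rw [← hT]
    exact T.injective
  refine ⟨hp.analytic_left.add (analyticOnNhd_const.mul hp.analytic_right),
    hp.analytic_right.add (analyticOnNhd_const.mul hp.analytic_left), ?_, ?_, ?_⟩
  · intro z hz
    have dh := (hp.analytic_left z hz).differentiableAt.hasDerivAt
    have dg := (hp.analytic_right z hz).differentiableAt.hasDerivAt
    rw [(dh.fun_add (dg.const_mul c)).deriv, (dg.fun_add (dh.const_mul (conj c))).deriv]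
    have hlt := hp.norm_deriv_lt z hz
    generalize deriv h z = A at *
    generalize deriv g z = B at *
    refine lt_of_pow_lt_pow_left₀ 2 (norm_nonneg _) ?_
    have : ‖A + c * B‖ ^ 2 - ‖B + conj c * A‖ ^ 2 = (1 - ‖c‖ ^ 2) * (‖A‖ ^ 2 - ‖B‖ ^ 2) := by
      simp only [← Complex.normSq_eq_norm_sq, Complex.normSq_apply]
      simp
      ring
    have h1 : 0 < (1 - ‖c‖ ^ 2) * (‖A‖ ^ 2 - ‖B‖ ^ 2) := by
      apply mul_pos
      · nlinarith [norm_nonneg c]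
      · nlinarith [norm_nonneg B]
    linarith
  · simp only [himg]
    exact hinj.injOn.comp hp.injOn (mapsTo_univ _ _)
  · intro a ha r hr
    simp only [himg]
    have := (hp.convex_image a ha r hr).linear_image (harmDeriv 1 (conj c) : ℂ →ₗ[ℝ] ℂ)
    rw [image_image] at this
    exact this

/-! ### Convexity of the image of a circle -/

lemma second_deriv_nonpos_of_isLocalMax {φ φ' : ℝ → ℝ} {c : ℝ}
    (hφ : ∀ᶠ t in 𝓝 (0 : ℝ), HasDerivAt φ (φ' t) t) (hφ' : HasDerivAt φ' c 0) (hmax : IsLocalMax φ 0) : φ' 0 = 0 ∧ c ≤ 0 := by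
  have h0 := hmax.hasDerivAt_eq_zero hφ.self_of_nhds
  refine ⟨h0, ?_⟩
  by_contra hc
  have hd : deriv φ =ᶠ[𝓝 0] φ' := hφ.mono fun t ht => ht.deriv
  have hmin := isLocalMin_of_deriv_deriv_pos (f := φ) (x₀ := 0)
    (by rw [hd.deriv_eq, hφ'.deriv]; exact not_le.1 hc)
    (by rw [hφ.self_of_nhds.deriv, h0]) hφ.self_of_nhds.continuousAt
  have hconst : φ =ᶠ[𝓝 0] fun _ => φ 0 := by
    filter_upwards [hmin, hmax] with t h1 h2 using le_antisymm h2 h1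
  have h2 : deriv (deriv φ) 0 = 0 := by
    have := hconst.deriv
    rw [this.deriv_eq]
    simp
  rw [hd.deriv_eq, hφ'.deriv] at h2
  exact hc h2.le

lemma hasDerivAt_circle (a ζ : ℂ) (t : ℝ) :
    HasDerivAt (fun t : ℝ => a + ζ * exp (t * I)) (I * (ζ * exp (t * I))) t := by
  have h1 : HasDerivAt (fun t : ℝ => (t : ℂ) * I) (1 * I) t :=
    (Complex.ofRealCLM.hasDerivAt (x := t)).mul_const I
  have := (h1.cexp.const_mul ζ).const_add a
  exact this.congr_deriv (by ring)

/-- A real functional on `ℂ` that vanishes at `I * d` is a multiple of `x ↦ Re (x / d)`. -/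
lemma apply_eq_re_div_mul {ℓ : ℂ →L[ℝ] ℝ} {d : ℂ} (hd : d ≠ 0) (h : ℓ (I * d) = 0) (x : ℂ) :
    ℓ x = (x / d).re * ℓ d := by
  have : x = (x / d).re • d + (x / d).im • (I * d) := by
    have h1 : x / d = (x / d).re + (x / d).im * I := (Complex.re_add_im _).symm
    simp only [Complex.real_smul]
    calc x = x / d * d := by field_simp
      _ = ((x / d).re + (x / d).im * I) * d := by rw [← h1]
      _ = _ := by ring
  conv_lhs => rw [this]
  rw [map_add, map_smul, map_smul, h, smul_zero, add_zero, smul_eq_mul]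

/-- The image of the circle with centre `z - ζ` through `z` has nonnegative curvature at `f z`,
expressed at a point with `g'(z) = 0`. -/
lemma AbsConvexPair.curvature_nonneg {h g : ℂ → ℂ} (hp : AbsConvexPair h g) {z ζ : ℂ}
    (hζ : ζ ≠ 0) (hzζ : ‖z - ζ‖ + ‖ζ‖ < 1) (hgz : deriv g z = 0) :
    0 ≤ (1 + ζ * (deriv (deriv h) z / deriv h z) +
      conj (ζ ^ 2 * deriv (deriv g) z) / (ζ * deriv h z)).re := by
  set a := z - ζ with ha
  set F : ℂ → ℂ := fun z => h z + conj (g z) with hF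
  have hcb : closedBall a ‖ζ‖ ⊆ ball (0 : ℂ) 1 := closedBall_subset_ball' (by
    rw [dist_zero_right]; linarith)
  have hb : ball a ‖ζ‖ ⊆ ball (0 : ℂ) 1 := ball_subset_closedBall.trans hcb
  have hzc : z ∈ closedBall a ‖ζ‖ := by simp [ha]
  have hzD := hcb hzc
  have hA0 : deriv h z ≠ 0 := norm_pos_iff.1 ((norm_nonneg _).trans_lt (hp.norm_deriv_lt z hzD))
  have hd0 : ζ * deriv h z ≠ 0 := mul_ne_zero hζ hA0
  have hzF : F z ∉ F '' ball a ‖ζ‖ := by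
    rintro ⟨y, hy, he⟩
    rw [hp.injOn (hb hy) hzD he] at hy
    simp [ha] at hy
  have hopen : IsOpen (F '' ball a ‖ζ‖) := isOpen_image_add_conj isOpen_ball
    (fun z hz => hp.analytic_left z (hb hz)) (fun z hz => hp.analytic_right z (hb hz))
    (fun z hz => hp.norm_deriv_lt z (hb hz))
  obtain ⟨ℓ, hℓ⟩ := geometric_hahn_banach_open_point
    (hp.convex_image a (hb (mem_ball_self (norm_pos_iff.2 hζ))) ‖ζ‖
      ⟨norm_pos_iff.2 hζ, by linarith⟩) hopen hzF
  have hle : ∀ w ∈ closedBall a ‖ζ‖, ℓ (F w) ≤ ℓ (F z) := by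
    intro w hw
    have hw' : w ∈ closure (ball a ‖ζ‖) := by rwa [closure_ball _ (norm_ne_zero_iff.2 hζ)]
    refine ContinuousWithinAt.closure_le hw' (f := fun w => ℓ (F w)) (g := fun _ => ℓ (F z)) ?_
      continuousWithinAt_const fun y hy => (hℓ _ ⟨y, hy, rfl⟩).le
    exact (ℓ.continuous.continuousAt.comp (continuousAt_add_conj (hp.analytic_left w (hcb hw))
      (hp.analytic_right w (hcb hw)))).continuousWithinAt
  -- the support functional along the circle
  set p : ℝ → ℂ := fun t => a + ζ * exp (t * I) with hpdef
  have hp0 : p 0 = z := by simp [hpdef, ha]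
  have hpc : ∀ t, p t ∈ closedBall a ‖ζ‖ := fun t => by
    simp [hpdef, Complex.norm_exp_ofReal_mul_I]
  have hmax : IsLocalMax (fun t => ℓ (F (p t))) 0 := Eventually.of_forall fun t => by
    simp only [hp0]; exact hle _ (hpc t)
  have hpd := hasDerivAt_circle a ζ
  have hconj : ∀ {k : ℝ → ℂ} {k' : ℂ} {t : ℝ}, HasDerivAt k k' t →
      HasDerivAt (fun t => conj (k t)) (conj k') t := fun hk =>
    (Complex.conjCLE : ℂ →L[ℝ] ℂ).hasFDerivAt.comp_hasDerivAt _ hk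
  have hcomp : ∀ {k : ℂ → ℂ}, AnalyticOnNhd ℂ k (ball 0 1) → ∀ t,
      HasDerivAt (fun t => k (p t)) (deriv k (p t) * (I * (ζ * exp (t * I)))) t := fun hk t =>
    ((hk _ (hcb (hpc t))).differentiableAt.hasDerivAt).comp t (hpd t)
  have hφ : ∀ t, HasDerivAt (fun t => ℓ (F (p t)))
      (ℓ (deriv h (p t) * (I * (ζ * exp (t * I))) +
        conj (deriv g (p t) * (I * (ζ * exp (t * I)))))) t := fun t =>
    ℓ.hasFDerivAt.comp_hasDerivAt t ((hcomp hp.analytic_left t).add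
      (hconj (hcomp hp.analytic_right t)))
  have hE : HasDerivAt (fun t : ℝ => I * (ζ * exp (t * I))) (-ζ) 0 := by
    have h1 := (hasDerivAt_circle 0 ζ 0).const_mul I
    simp only [zero_add, ofReal_zero, zero_mul, exp_zero, mul_one] at h1
    exact h1.congr_deriv (by rw [← mul_assoc, I_mul_I]; ring)
  have hsec : ∀ {k : ℂ → ℂ}, AnalyticOnNhd ℂ k (ball 0 1) →
      HasDerivAt (fun t : ℝ => deriv k (p t) * (I * (ζ * exp (t * I))))
        (-(ζ * deriv k z + ζ ^ 2 * deriv (deriv k) z)) 0 := by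
    intro k hk
    have h1 := (hcomp hk.deriv 0).mul hE
    simp only [hp0, ofReal_zero, zero_mul, exp_zero, mul_one] at h1
    exact h1.congr_deriv (by linear_combination (ζ ^ 2 * deriv (deriv k) z) * I_mul_I)
  obtain ⟨hfirst, hsecond⟩ := second_deriv_nonpos_of_isLocalMax (Eventually.of_forall hφ)
    (ℓ.hasFDerivAt.comp_hasDerivAt 0 ((hsec hp.analytic_left).add
      (hconj (hsec hp.analytic_right)))) hmax
  simp only [hp0, hgz, ofReal_zero, zero_mul, exp_zero, mul_one, map_zero, add_zero, mul_zero,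
    zero_add] at hfirst hsecond
  have htan : ℓ (I * (ζ * deriv h z)) = 0 := by rw [← hfirst]; congr 1; ring
  have hform := apply_eq_re_div_mul hd0 htan
  have hne : ℓ (ζ * deriv h z) ≠ 0 := by
    intro h0
    have := hℓ (F a) ⟨a, mem_ball_self (norm_pos_iff.2 hζ), rfl⟩
    rw [hform (F a), hform (F z), h0, mul_zero, mul_zero] at this
    exact lt_irrefl _ this
  -- the support functional increases in the outward radial direction
  have hpos : 0 < ℓ (ζ * deriv h z) := by
    refine lt_of_le_of_ne (not_lt.1 fun hneg => ?_) hne.symm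
    have hza : z - a = ζ := by simp [ha]
    have := re_pos_of_le_on_ball (a := a) (z := z) (v := -ζ) (φ := fun w => ℓ (F w))
      (by rw [← sub_ne_zero, hza]; exact hζ)
      (ℓ.hasFDerivAt.comp z (hasStrictFDerivAt_add_conj (hp.analytic_left z hzD).hasStrictDerivAt
        (hp.analytic_right z hzD).hasStrictDerivAt).hasFDerivAt)
      (fun w hw => hle w (ball_subset_closedBall (by rwa [hza] at hw))) (by
        have : harmDeriv (deriv h z) (deriv g z) (-ζ) = -(ζ * deriv h z) := by
          rw [harmDeriv_apply, hgz]; simp [mul_comm]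
        rw [ContinuousLinearMap.comp_apply, this, map_neg]
        linarith)
    rw [hza] at this
    simp at this
    nlinarith [mul_self_nonneg ζ.re, mul_self_nonneg ζ.im]
  rw [hform] at hsecond
  have hre := nonpos_of_mul_nonpos_left hsecond hpos
  have hfin : (-(ζ * deriv h z + ζ ^ 2 * deriv (deriv h) z) + conj (-(ζ ^ 2 * deriv (deriv g) z))) /
      (ζ * deriv h z) = -(1 + ζ * (deriv (deriv h) z / deriv h z) +
        conj (ζ ^ 2 * deriv (deriv g) z) / (ζ * deriv h z)) := by
    rw [map_neg]
    field_simp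
    ring
  rw [hfin, Complex.neg_re] at hre
  linarith

/-- The curvature condition in the limit of the disks through `z`, with centre in direction `-e`, that
touch the unit circle. -/
lemma AbsConvexPair.trig_nonneg {h g : ℂ → ℂ} (hp : AbsConvexPair h g) {z : ℂ}
    (hz : z ∈ ball (0 : ℂ) 1) (hgz : deriv g z = 0) {e : ℂ} (he : ‖e‖ = 1) :
    0 ≤ 1 + (e * ((1 - ‖z‖ ^ 2) / 2 * (deriv (deriv h) z / deriv h z) - conj z)).re +
      (e ^ 3 * ((1 - ‖z‖ ^ 2) / 2 * (deriv (deriv g) z / conj (deriv h z)))).re := by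
  have hz1 : ‖z‖ < 1 := by simpa using hz
  have hA0 : deriv h z ≠ 0 := norm_pos_iff.1 ((norm_nonneg _).trans_lt (hp.norm_deriv_lt z hz))
  have he0 : e ≠ 0 := by rintro rfl; simp at he
  have hee : conj e * e = 1 := by
    rw [mul_comm, Complex.mul_conj, Complex.normSq_eq_norm_sq, he]; simp
  set x := (conj z * e).re with hx
  set M := 1 - ‖z‖ ^ 2 with hM
  have hM0 : 0 < M := by rw [hM]; nlinarith [norm_nonneg z]
  have hx1 : x < 1 := by
    have := Complex.re_le_norm (conj z * e)
    rw [norm_mul, he, RCLike.norm_conj, mul_one] at this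
    linarith
  set X := (e * (deriv (deriv h) z / deriv h z)).re with hX
  set Y := (e ^ 3 * (deriv (deriv g) z / conj (deriv h z))).re with hY
  have hM2 : M < 2 * (1 - x) := by
    have h1 : 0 < Complex.normSq (e - z) := by
      refine Complex.normSq_pos.2 (sub_ne_zero.2 ?_)
      rintro rfl; linarith
    rw [Complex.normSq_sub, Complex.normSq_eq_norm_sq, Complex.normSq_eq_norm_sq, he,
      mul_comm e, ← hx] at h1
    rw [hM]
    linarith
  -- the disk with centre `z - ρ e` and radius `ρ` lies in the unit disk iff `ρ ≤ ρ₀`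
  set ρ₀ := M / (2 * (1 - x)) with hρ₀
  have hρ₀0 : 0 < ρ₀ := div_pos hM0 (by linarith)
  have hρ₀1 : ρ₀ < 1 := by rw [hρ₀, div_lt_one (by linarith)]; exact hM2
  have key : ∀ ρ ∈ Ioo 0 ρ₀, 0 ≤ 1 + ρ * (X + Y) := by
    rintro ρ ⟨hρ0, hρ⟩
    have hnρ : ‖(ρ : ℂ) * e‖ = ρ := by
      rw [norm_mul, he, mul_one, Complex.norm_real, Real.norm_eq_abs, abs_of_pos hρ0]
    have hlt : ‖z - ρ * e‖ < 1 - ρ := by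
      refine lt_of_pow_lt_pow_left₀ 2 (by linarith) ?_
      rw [← Complex.normSq_eq_norm_sq, Complex.normSq_sub, Complex.normSq_eq_norm_sq,
        Complex.normSq_eq_norm_sq, hnρ]
      have h1 : (z * conj ((ρ : ℂ) * e)).re = ρ * x := by
        rw [hx]; simp; ring
      have h2 : ρ * (2 * (1 - x)) < M := (lt_div_iff₀ (by linarith)).1 hρ
      rw [h1]
      rw [hM] at h2
      nlinarith
    have hcur := hp.curvature_nonneg (z := z) (ζ := ρ * e)
      (mul_ne_zero (by exact_mod_cast hρ0.ne') he0) (by rw [hnρ]; linarith) hgz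
    have hρc : (ρ : ℂ) ≠ 0 := by exact_mod_cast hρ0.ne'
    have e1 : (ρ : ℂ) * e * (deriv (deriv h) z / deriv h z) =
        (ρ : ℂ) * (e * (deriv (deriv h) z / deriv h z)) := by ring
    have e2 : conj (((ρ : ℂ) * e) ^ 2 * deriv (deriv g) z) / (ρ * e * deriv h z) =
        (ρ : ℂ) * conj (e ^ 3 * (deriv (deriv g) z / conj (deriv h z))) := by
      have : conj e ≠ 0 := by simpa using he0
      simp only [map_mul, map_pow, map_div₀, Complex.conj_ofReal, Complex.conj_conj]
      field_simp
      linear_combination (-conj (deriv (deriv g) z)) * hee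
    rw [e1, e2, Complex.add_re, Complex.add_re, Complex.re_ofReal_mul, Complex.re_ofReal_mul,
      Complex.conj_re, Complex.one_re, ← hX, ← hY] at hcur
    linarith
  have hlim : 0 ≤ 1 + ρ₀ * (X + Y) := by
    refine ge_of_tendsto (f := fun ρ : ℝ => 1 + ρ * (X + Y)) (x := 𝓝[<] ρ₀) ?_
      (by filter_upwards [Ioo_mem_nhdsLT hρ₀0] with ρ hρ using key ρ hρ)
    exact (Continuous.tendsto (by fun_prop) ρ₀).mono_left nhdsWithin_le_nhds
  have h3 : 0 ≤ (1 - x) * (1 + ρ₀ * (X + Y)) := mul_nonneg (by linarith) hlim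
  have h4 : (1 - x) * (1 + ρ₀ * (X + Y)) = 1 - x + M / 2 * (X + Y) := by
    rw [hρ₀]
    have : 1 - x ≠ 0 := by linarith
    field_simp
  have h5 : (e * ((1 - ‖z‖ ^ 2) / 2 * (deriv (deriv h) z / deriv h z) - conj z)).re =
      M / 2 * X - x := by
    have : e * ((1 - ‖z‖ ^ 2) / 2 * (deriv (deriv h) z / deriv h z) - conj z) =
        ((M / 2 : ℝ) : ℂ) * (e * (deriv (deriv h) z / deriv h z)) - conj z * e := by
      rw [hM]; push_cast; ring
    rw [this, Complex.sub_re, Complex.re_ofReal_mul]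
  have h6 : (e ^ 3 * ((1 - ‖z‖ ^ 2) / 2 * (deriv (deriv g) z / conj (deriv h z)))).re =
      M / 2 * Y := by
    have : e ^ 3 * ((1 - ‖z‖ ^ 2) / 2 * (deriv (deriv g) z / conj (deriv h z))) =
        ((M / 2 : ℝ) : ℂ) * (e ^ 3 * (deriv (deriv g) z / conj (deriv h z))) := by
      rw [hM]; push_cast; ring
    rw [this, Complex.re_ofReal_mul]
  rw [h5, h6]
  linarith

/-- A nonnegative trigonometric polynomial `1 + Re (e a) + Re (e³ b)` has `|a| ≤ 2/√3`: with
`e₀ a = -|a|`, the values at `e₀ exp (iπ/6)` and `e₀ exp (-iπ/6)` add up to `2 - √3 |a|`, the cubes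
of these points being opposite. -/
lemma norm_le_of_trig_nonneg {a b : ℂ}
    (hab : ∀ e : ℂ, ‖e‖ = 1 → 0 ≤ 1 + (e * a).re + (e ^ 3 * b).re) : ‖a‖ ≤ 2 / √3 := by
  by_cases ha : a = 0
  · rw [ha, norm_zero]; positivity
  have hs : √3 * √3 = 3 := Real.mul_self_sqrt (by norm_num)
  have hsc : ((√3 : ℝ) : ℂ) * ((√3 : ℝ) : ℂ) = 3 := by exact_mod_cast hs
  have hna : 0 < ‖a‖ := norm_pos_iff.2 ha
  have hnac : (‖a‖ : ℂ) ≠ 0 := by exact_mod_cast hna.ne'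
  set e₀ : ℂ := -(conj a / ‖a‖) with he₀
  have hne₀ : ‖e₀‖ = 1 := by
    rw [he₀, norm_neg, norm_div, RCLike.norm_conj, Complex.norm_real, norm_norm, div_self hna.ne']
  have he₀a : e₀ * a = -‖a‖ := by
    have : conj a * a = ‖a‖ ^ 2 := by
      rw [mul_comm, Complex.mul_conj, Complex.normSq_eq_norm_sq]; push_cast; ring
    rw [he₀]
    field_simp
    linear_combination -this
  have hω : ∀ s : ℝ, s ^ 2 = 1 → ‖((√3 / 2 : ℝ) : ℂ) + ((s / 2 : ℝ) : ℂ) * I‖ = 1 := by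
    intro s hs1
    rw [← pow_eq_one_iff_of_nonneg (norm_nonneg _) two_ne_zero, ← Complex.normSq_eq_norm_sq,
      Complex.normSq_add_mul_I]
    nlinarith
  have hcube : ∀ s : ℝ, s ^ 2 = 1 →
      (((√3 / 2 : ℝ) : ℂ) + ((s / 2 : ℝ) : ℂ) * I) ^ 3 = s * I := by
    intro s hs1
    have hs1c : (s : ℂ) ^ 2 = 1 := by exact_mod_cast hs1
    push_cast
    linear_combination ((√3 : ℝ) / 8 + 3 / 8 * s * I : ℂ) * hsc +
      (3 * (√3 : ℝ) / 8 * I ^ 2 + s * I ^ 3 / 8 : ℂ) * hs1c +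
      (3 * (√3 : ℝ) / 8 + s * I / 8 : ℂ) * I_sq
  have h1 := hab (e₀ * (((√3 / 2 : ℝ) : ℂ) + (((1 : ℝ) / 2 : ℝ) : ℂ) * I))
    (by rw [norm_mul, hne₀, hω 1 (by norm_num), mul_one])
  have h2 := hab (e₀ * (((√3 / 2 : ℝ) : ℂ) + (((-1 : ℝ) / 2 : ℝ) : ℂ) * I))
    (by rw [norm_mul, hne₀, hω (-1) (by norm_num), mul_one])
  rw [mul_pow, hcube 1 (by norm_num)] at h1
  rw [mul_pow, hcube (-1) (by norm_num)] at h2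
  have h3 : ∀ s : ℝ, (e₀ * (((√3 / 2 : ℝ) : ℂ) + ((s / 2 : ℝ) : ℂ) * I) * a).re =
      -(‖a‖ * (√3 / 2)) := by
    intro s
    have : e₀ * (((√3 / 2 : ℝ) : ℂ) + ((s / 2 : ℝ) : ℂ) * I) * a =
        ((-(‖a‖ * (√3 / 2)) : ℝ) : ℂ) + ((-‖a‖ * (s / 2) : ℝ) : ℂ) * I := by
      rw [mul_right_comm, he₀a]; push_cast; ring
    rw [this]; simp
  have h4 : (e₀ ^ 3 * (((1 : ℝ) : ℂ) * I) * b).re + (e₀ ^ 3 * (((-1 : ℝ) : ℂ) * I) * b).re = 0 := by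
    rw [← Complex.add_re]
    have : e₀ ^ 3 * (((1 : ℝ) : ℂ) * I) * b + e₀ ^ 3 * (((-1 : ℝ) : ℂ) * I) * b = 0 := by
      push_cast; ring
    rw [this, Complex.zero_re]
  rw [h3] at h1 h2
  rw [le_div_iff₀ (by positivity)]
  linarith

/-! ### The order of the affine hull -/

/-- The Schwarz-Pick inequality at a zero. -/
lemma norm_deriv_mul_le_one_of_eq_zero {w : ℂ → ℂ} (hw : DifferentiableOn ℂ w (ball 0 1))
    (hb : ∀ z ∈ ball (0 : ℂ) 1, ‖w z‖ < 1) {z₀ : ℂ} (hz₀ : z₀ ∈ ball (0 : ℂ) 1) (h0 : w z₀ = 0) :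
    (1 - ‖z₀‖ ^ 2) * ‖deriv w z₀‖ ≤ 1 := by
  have hz₀' : ‖z₀‖ < 1 := by simpa using hz₀
  have hden : ∀ ζ ∈ ball (0 : ℂ) 1, 1 + conj z₀ * ζ ≠ 0 := by
    intro ζ hζ h
    have h1 : ‖conj z₀ * ζ‖ = 1 := by
      rw [eq_neg_of_add_eq_zero_right h]; simp
    rw [norm_mul, RCLike.norm_conj] at h1
    have hζ' : ‖ζ‖ < 1 := by simpa using hζ
    nlinarith [norm_nonneg z₀, norm_nonneg ζ]
  -- the disk automorphism taking `0` to `z₀`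
  set m : ℂ → ℂ := fun ζ => (ζ + z₀) / (1 + conj z₀ * ζ) with hm
  have hmaps : MapsTo m (ball 0 1) (ball 0 1) := by
    intro ζ hζ
    have hζ' : ‖ζ‖ < 1 := by simpa using hζ
    rw [mem_ball_zero_iff, hm]
    simp only
    rw [norm_div, div_lt_one (norm_pos_iff.2 (hden ζ hζ))]
    refine lt_of_pow_lt_pow_left₀ 2 (norm_nonneg _) ?_
    have : ‖1 + conj z₀ * ζ‖ ^ 2 - ‖ζ + z₀‖ ^ 2 = (1 - ‖z₀‖ ^ 2) * (1 - ‖ζ‖ ^ 2) := by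
      simp only [← Complex.normSq_eq_norm_sq, Complex.normSq_apply]
      simp
      ring
    have h1 : 0 < (1 - ‖z₀‖ ^ 2) * (1 - ‖ζ‖ ^ 2) := by
      apply mul_pos
      · nlinarith [norm_nonneg z₀]
      · nlinarith [norm_nonneg ζ]
    linarith
  have hmd : DifferentiableOn ℂ m (ball 0 1) := by
    refine DifferentiableOn.div (by fun_prop) (by fun_prop) hden
  have hm0 : m 0 = z₀ := by simp [hm]
  have hm' : HasDerivAt m (1 - ‖z₀‖ ^ 2) 0 := by
    have h1 : HasDerivAt (fun ζ : ℂ => ζ + z₀) 1 0 := (hasDerivAt_id _).add_const z₀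
    have h2 : HasDerivAt (fun ζ : ℂ => 1 + conj z₀ * ζ) (conj z₀) 0 := by
      simpa using ((hasDerivAt_id (0 : ℂ)).const_mul (conj z₀)).const_add 1
    have h3 := h1.div h2 (by simp)
    have h4 : z₀ * conj z₀ = ‖z₀‖ ^ 2 := by
      rw [Complex.mul_conj, Complex.normSq_eq_norm_sq]; push_cast; ring
    simp only [mul_zero, add_zero, mul_one, zero_add, one_pow, div_one, h4] at h3
    exact h3
  have hwd : HasDerivAt w (deriv w z₀) (m 0) := by
    rw [hm0]
    exact (hw.differentiableAt (isOpen_ball.mem_nhds hz₀)).hasDerivAt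
  have hcomp := hwd.comp 0 hm'
  have := Complex.norm_deriv_le_one_of_mapsTo_ball (f := w ∘ m) (c := 0) (R := 1)
    (hw.comp hmd hmaps) (by
      intro ζ hζ
      have := hb _ (hmaps hζ)
      rw [Function.comp_apply, hm0, h0]
      simpa using this.le) one_pos
  rw [hcomp.deriv, norm_mul] at this
  have hn : ‖(1 - (‖z₀‖ : ℂ) ^ 2)‖ = 1 - ‖z₀‖ ^ 2 := by
    have : (1 - (‖z₀‖ : ℂ) ^ 2) = ((1 - ‖z₀‖ ^ 2 : ℝ) : ℂ) := by push_cast; ring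
    rw [this, Complex.norm_real, Real.norm_eq_abs, abs_of_nonneg]
    nlinarith [norm_nonneg z₀]
  rw [hn] at this
  linarith

/-- The Schwarz-Pick inequality for the dilatation `g' / h'` at a zero of `g'`. -/
lemma AbsConvexPair.norm_second_deriv_right_le {h g : ℂ → ℂ} (hp : AbsConvexPair h g) {z : ℂ}
    (hz : z ∈ ball (0 : ℂ) 1) (hgz : deriv g z = 0) :
    (1 - ‖z‖ ^ 2) * ‖deriv (deriv g) z / deriv h z‖ ≤ 1 := by
  have hA0 : ∀ w ∈ ball (0 : ℂ) 1, deriv h w ≠ 0 := fun w hw =>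
    norm_pos_iff.1 ((norm_nonneg _).trans_lt (hp.norm_deriv_lt w hw))
  have hd := norm_deriv_mul_le_one_of_eq_zero (w := fun w => deriv g w / deriv h w) (z₀ := z)
    (hp.analytic_right.deriv.differentiableOn.div hp.analytic_left.deriv.differentiableOn hA0)
    (fun w hw => by
      rw [norm_div, div_lt_one (norm_pos_iff.2 (hA0 w hw))]
      exact hp.norm_deriv_lt w hw) hz (by simp [hgz])
  have h1 := (hp.analytic_right.deriv z hz).differentiableAt.hasDerivAt.fun_div
    (hp.analytic_left.deriv z hz).differentiableAt.hasDerivAt (hA0 z hz)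
  rw [h1.deriv, hgz, zero_mul, sub_zero] at hd
  have h2 : deriv (deriv g) z * deriv h z / deriv h z ^ 2 = deriv (deriv g) z / deriv h z := by
    have := hA0 z hz
    field_simp
  rwa [h2] at hd

lemma AbsConvexPair.norm_preSchwarzian_le {h g : ℂ → ℂ} (hp : AbsConvexPair h g) {z : ℂ}
    (hz : z ∈ ball (0 : ℂ) 1) (hgz : deriv g z = 0) :
    ‖(1 - ‖z‖ ^ 2) / 2 * (deriv (deriv h) z / deriv h z) - conj z‖ ≤ 2 / √3 :=
  norm_le_of_trig_nonneg fun _ he => hp.trig_nonneg hz hgz he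

/-- With `H = h + c g` and `G = g + conj c h`, where `c` is such that `G'(z) = 0`, the function
`h + ε g` is a multiple of `H + δ G` for some `|δ| ≤ 1`. The bound is the sum of the one for `H`, which
is `2/√3`, and of the Schwarz-Pick bound `1/2` for the term with `G`. -/
theorem AbsConvexPair.norm_preSchwarzian_add_le {h g : ℂ → ℂ} (hp : AbsConvexPair h g) {z ε : ℂ}
    (hz : z ∈ ball (0 : ℂ) 1) (hε : ‖ε‖ ≤ 1) :
    ‖(1 - ‖z‖ ^ 2) / 2 * ((deriv (deriv h) z + ε * deriv (deriv g) z) /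
      (deriv h z + ε * deriv g z)) - conj z‖ ≤ 2 / √3 + 1 / 2 := by
  have hlt := hp.norm_deriv_lt z hz
  have hA0 : deriv h z ≠ 0 := norm_pos_iff.1 ((norm_nonneg _).trans_lt hlt)
  set c : ℂ := -conj (deriv g z / deriv h z) with hc
  have hcn : ‖c‖ < 1 := by
    rw [hc, norm_neg, RCLike.norm_conj, norm_div, div_lt_one (norm_pos_iff.2 hA0)]; exact hlt
  have hq := hp.affine hcn
  have hz1 : ‖z‖ < 1 := by simpa using hz
  have dh : ∀ w ∈ ball (0 : ℂ) 1, HasDerivAt h (deriv h w) w := fun w hw =>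
    (hp.analytic_left w hw).differentiableAt.hasDerivAt
  have dg : ∀ w ∈ ball (0 : ℂ) 1, HasDerivAt g (deriv g w) w := fun w hw =>
    (hp.analytic_right w hw).differentiableAt.hasDerivAt
  have ddh := (hp.analytic_left.deriv z hz).differentiableAt.hasDerivAt
  have ddg := (hp.analytic_right.deriv z hz).differentiableAt.hasDerivAt
  have hH : ∀ w ∈ ball (0 : ℂ) 1, deriv (fun z => h z + c * g z) w = deriv h w + c * deriv g w :=
    fun w hw => ((dh w hw).fun_add ((dg w hw).const_mul c)).deriv
  have hG : ∀ w ∈ ball (0 : ℂ) 1,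
      deriv (fun z => g z + conj c * h z) w = deriv g w + conj c * deriv h w :=
    fun w hw => ((dg w hw).fun_add ((dh w hw).const_mul (conj c))).deriv
  have hHH : deriv (deriv (fun z => h z + c * g z)) z =
      deriv (deriv h) z + c * deriv (deriv g) z := by
    have : deriv (fun z => h z + c * g z) =ᶠ[𝓝 z] fun w => deriv h w + c * deriv g w := by
      filter_upwards [isOpen_ball.mem_nhds hz] with w hw using hH w hw
    rw [this.deriv_eq]
    exact (ddh.fun_add (ddg.const_mul c)).deriv
  have hGG : deriv (deriv (fun z => g z + conj c * h z)) z =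
      deriv (deriv g) z + conj c * deriv (deriv h) z := by
    have : deriv (fun z => g z + conj c * h z) =ᶠ[𝓝 z]
        fun w => deriv g w + conj c * deriv h w := by
      filter_upwards [isOpen_ball.mem_nhds hz] with w hw using hG w hw
    rw [this.deriv_eq]
    exact (ddg.fun_add (ddh.const_mul (conj c))).deriv
  have hGz : deriv (fun z => g z + conj c * h z) z = 0 := by
    rw [hG z hz, hc]
    simp only [map_neg, Complex.conj_conj]
    field_simp
    ring
  have b1 := hq.norm_preSchwarzian_le hz hGz
  have b2 := hq.norm_second_deriv_right_le hz hGz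
  have hH0 : deriv (fun z => h z + c * g z) z ≠ 0 :=
    norm_pos_iff.1 ((norm_nonneg _).trans_lt (hq.norm_deriv_lt z hz))
  rw [hG z hz] at hGz
  rw [hHH, hH z hz] at b1
  rw [hGG, hH z hz] at b2
  rw [hH z hz] at hH0
  have hK0 : deriv h z + ε * deriv g z ≠ 0 := by
    intro h0
    have h1 : ‖deriv h z‖ = ‖ε * deriv g z‖ := by rw [eq_neg_of_add_eq_zero_left h0, norm_neg]
    rw [norm_mul] at h1
    nlinarith [norm_nonneg (deriv g z), norm_nonneg ε]
  generalize deriv (deriv h) z = h2 at *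
  generalize deriv (deriv g) z = g2 at *
  generalize deriv h z = A at *
  generalize deriv g z = B at *
  have hD0 : 1 - ε * conj c ≠ 0 := by
    intro h0
    have h1 : ‖ε * conj c‖ = 1 := by rw [← sub_eq_zero.1 h0]; simp
    rw [norm_mul, RCLike.norm_conj] at h1
    nlinarith [norm_nonneg c, norm_nonneg ε]
  set δ := (ε - c) / (1 - ε * conj c) with hδ
  have hδn : ‖δ‖ ≤ 1 := by
    rw [hδ, norm_div, div_le_one (norm_pos_iff.2 hD0)]
    refine le_of_sq_le_sq ?_ (norm_nonneg _)
    have : ‖1 - ε * conj c‖ ^ 2 - ‖ε - c‖ ^ 2 = (1 - ‖ε‖ ^ 2) * (1 - ‖c‖ ^ 2) := by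
      simp only [← Complex.normSq_eq_norm_sq, Complex.normSq_apply]
      simp
      ring
    have h1 : 0 ≤ (1 - ‖ε‖ ^ 2) * (1 - ‖c‖ ^ 2) := by
      apply mul_nonneg
      · nlinarith [norm_nonneg ε]
      · nlinarith [norm_nonneg c]
    linarith
  have hδD : δ * (1 - ε * conj c) = ε - c := by rw [hδ]; field_simp
  have hid : (h2 + ε * g2) / (A + ε * B) =
      (h2 + c * g2) / (A + c * B) + δ * ((g2 + conj c * h2) / (A + c * B)) := by
    rw [← mul_div_assoc, ← add_div, div_eq_div_iff hK0 hH0]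
    apply mul_left_cancel₀ hD0
    have hB : B = -(conj c * A) := eq_neg_of_add_eq_zero_left hGz
    rw [hB]
    linear_combination (-(g2 + conj c * h2) * (A - ε * (conj c * A))) * hδD
  have hsplit : (1 - ‖z‖ ^ 2) / 2 * ((h2 + ε * g2) / (A + ε * B)) - conj z =
      ((1 - ‖z‖ ^ 2) / 2 * ((h2 + c * g2) / (A + c * B)) - conj z) +
        δ * (((1 - ‖z‖ ^ 2 : ℝ) : ℂ) * ((g2 + conj c * h2) / (A + c * B))) / 2 := by
    rw [hid]; push_cast; ring
  rw [hsplit]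
  refine (norm_add_le _ _).trans (add_le_add b1 ?_)
  rw [norm_div, norm_mul, norm_mul, Complex.norm_real, Real.norm_eq_abs, abs_of_nonneg
    (by nlinarith [norm_nonneg z])]
  have : ‖(2 : ℂ)‖ = 2 := by simp
  rw [this]
  have := mul_le_mul hδn b2 (mul_nonneg (by nlinarith [norm_nonneg z]) (norm_nonneg _)) zero_le_one
  linarith

/-! ### The comparison functions -/

/-- The bound `(1 + t) ^ (α - 1) / (1 - t) ^ (α + 1)` for the derivative at `|z| = t`. The lower bound
is its value at `-t`. -/
noncomputable def distortionBound (α t : ℝ) : ℝ := (1 + t) ^ (α - 1) / (1 - t) ^ (α + 1)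

/-- The primitive of `distortionBound α` that vanishes at `0`, so that the lower growth bound at
`|z| = t` is `-growthBound α (-t)`. -/
noncomputable def growthBound (α t : ℝ) : ℝ := (((1 + t) / (1 - t)) ^ α - 1) / (2 * α)

lemma distortionBound_pos {α t : ℝ} (h1 : -1 < t) (h2 : t < 1) : 0 < distortionBound α t :=
  div_pos (Real.rpow_pos_of_pos (by linarith) _) (Real.rpow_pos_of_pos (by linarith) _)

lemma log_distortionBound {α t : ℝ} (h1 : -1 < t) (h2 : t < 1) :
    Real.log (distortionBound α t) =
      (α - 1) * Real.log (1 + t) - (α + 1) * Real.log (1 - t) := by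
  have h3 : 0 < 1 + t := by linarith
  have h4 : 0 < 1 - t := by linarith
  rw [distortionBound, Real.log_div (Real.rpow_pos_of_pos h3 _).ne'
    (Real.rpow_pos_of_pos h4 _).ne', Real.log_rpow h3, Real.log_rpow h4]

lemma hasDerivAt_growthBound {α t : ℝ} (hα : 0 < α) (h1 : -1 < t) (h2 : t < 1) :
    HasDerivAt (growthBound α) (distortionBound α t) t := by
  have h3 : 0 < 1 + t := by linarith
  have h4 : 0 < 1 - t := by linarith
  have hq : HasDerivAt (fun t : ℝ => (1 + t) / (1 - t)) (2 / (1 - t) ^ 2) t := by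
    have := ((hasDerivAt_id t).const_add 1).fun_div ((hasDerivAt_id t).const_sub 1) h4.ne'
    refine this.congr_deriv ?_
    simp only [id]
    congr 1
    ring
  have := ((hq.rpow_const (p := α) (Or.inl (div_pos h3 h4).ne')).sub_const 1).div_const (2 * α)
  refine this.congr_deriv ?_
  have h5 : (1 - t) ^ (α + 1) = (1 - t) ^ (α - 1) * (1 - t) ^ 2 := by
    rw [← Real.rpow_natCast (1 - t) 2, ← Real.rpow_add h4]
    congr 1
    push_cast
    ring
  rw [distortionBound, Real.div_rpow h3.le h4.le, h5]
  have := (Real.rpow_pos_of_pos h4 (α - 1)).ne'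
  field_simp

lemma growthBound_zero (α : ℝ) : growthBound α 0 = 0 := by simp [growthBound]

/-- The number `2/√3 + 1/2`, which bounds the second coefficient of `h` for the absolutely convex
harmonic maps without the condition `g'(0) = 0`. -/
noncomputable def absConvexOrder : ℝ := 2 / √3 + 1 / 2

lemma absConvexOrder_pos : 0 < absConvexOrder := by unfold absConvexOrder; positivity

lemma absConvexOrder_eq : absConvexOrder = (√3 + 4) / (2 * √3) := by
  have : √3 ≠ 0 := by positivity
  unfold absConvexOrder
  field_simp
  ring

lemma growthBound_absConvexOrder (t : ℝ) : growthBound absConvexOrder t =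
    √3 / (√3 + 4) * (((1 + t) / (1 - t)) ^ ((√3 + 4) / (2 * √3)) - 1) := by
  rw [growthBound, absConvexOrder_eq]
  have : √3 ≠ 0 := by positivity
  have h2 : √3 + 4 ≠ 0 := by positivity
  field_simp

/-! ### Distortion -/

/-- The radial component, along the ray through `e`, of the bound for `h + ε g`. -/
lemma AbsConvexPair.abs_re_sub_le {h g : ℂ → ℂ} (hp : AbsConvexPair h g) {ε e : ℂ} {t : ℝ}
    (ht : t ∈ Ico (0 : ℝ) 1) (hε : ‖ε‖ ≤ 1) (he : ‖e‖ = 1) :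
    |(1 - t ^ 2) / 2 * ((deriv (deriv h) (t * e) + ε * deriv (deriv g) (t * e)) * e /
      (deriv h (t * e) + ε * deriv g (t * e))).re - t| ≤ absConvexOrder := by
  have hn : ‖(t : ℂ) * e‖ = t := by
    rw [norm_mul, he, mul_one, Complex.norm_real, Real.norm_eq_abs, abs_of_nonneg ht.1]
  have hb := hp.norm_preSchwarzian_add_le (z := t * e) (by rw [mem_ball_zero_iff, hn]; exact ht.2) hε
  rw [hn] at hb
  refine le_trans ?_ hb
  set Q := deriv (deriv h) (t * e) + ε * deriv (deriv g) (t * e)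
  set k := deriv h (t * e) + ε * deriv g (t * e)
  have hee : conj e * e = 1 := by
    rw [mul_comm, Complex.mul_conj, Complex.normSq_eq_norm_sq, he]; simp
  have : (1 - t ^ 2) / 2 * (Q * e / k).re - t =
      (((1 - (t : ℂ) ^ 2) / 2 * (Q / k) - conj (t * e)) * e).re := by
    have h1 : ((1 - (t : ℂ) ^ 2) / 2 * (Q / k) - conj (t * e)) * e =
        (((1 - t ^ 2) / 2 : ℝ) : ℂ) * (Q * e / k) - (t : ℝ) := by
      rw [map_mul, Complex.conj_ofReal]
      push_cast
      linear_combination (-(t : ℂ)) * hee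
    rw [h1, Complex.sub_re, Complex.re_ofReal_mul, Complex.ofReal_re]
  rw [this]
  refine (Complex.abs_re_le_norm _).trans ?_
  rw [norm_mul, he, mul_one]

lemma hasDerivAt_log_norm_sq {k : ℝ → ℂ} {k' : ℂ} {t : ℝ} (hk : HasDerivAt k k' t)
    (h0 : k t ≠ 0) : HasDerivAt (fun s => Real.log (‖k s‖ ^ 2)) (2 * (k' / k t).re) t := by
  refine (hk.norm_sq.log (by simpa using h0)).congr_deriv ?_
  rw [Complex.inner, Complex.div_re, ← Complex.normSq_eq_norm_sq]
  simp only [Complex.mul_re, Complex.conj_re, Complex.conj_im]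
  have := (Complex.normSq_pos.2 h0).ne'
  field_simp
  ring

lemma hasDerivAt_log_distortionBound {α t : ℝ} (h1 : -1 < t) (h2 : t < 1) :
    HasDerivAt (fun s => Real.log (distortionBound α s)) ((2 * α + 2 * t) / (1 - t ^ 2)) t := by
  have h3 : 1 + t ≠ 0 := by linarith
  have h4 : 1 - t ≠ 0 := by linarith
  have hd : HasDerivAt (fun s : ℝ => (α - 1) * Real.log (1 + s) - (α + 1) * Real.log (1 - s))
      ((2 * α + 2 * t) / (1 - t ^ 2)) t := by
    have a1 := (((hasDerivAt_id t).const_add 1).log h3).const_mul (α - 1)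
    have a2 := (((hasDerivAt_id t).const_sub 1).log h4).const_mul (α + 1)
    refine (a1.sub a2).congr_deriv ?_
    have h5 : 1 - t ^ 2 = (1 + t) * (1 - t) := by ring
    rw [h5]
    simp only [id]
    field_simp
    ring
  refine hd.congr_of_eventuallyEq ?_
  filter_upwards [Ioo_mem_nhds h1 h2] with s hs using log_distortionBound hs.1 hs.2

/-- Two-sided distortion estimate for `h + ε g` along a ray, by comparing logarithmic derivatives. -/
theorem AbsConvexPair.distortion_ray {h g : ℂ → ℂ} (hp : AbsConvexPair h g)
    (hh0 : deriv h 0 = 1) (hg0 : deriv g 0 = 0) {ε e : ℂ} {t : ℝ}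
    (ht : t ∈ Ico (0 : ℝ) 1) (hε : ‖ε‖ ≤ 1) (he : ‖e‖ = 1) :
    distortionBound absConvexOrder (-t) ≤ ‖deriv h (t * e) + ε * deriv g (t * e)‖ ∧
      ‖deriv h (t * e) + ε * deriv g (t * e)‖ ≤ distortionBound absConvexOrder t := by
  set α := absConvexOrder with hα
  have hmem : ∀ s ∈ Ico (0 : ℝ) 1, (s : ℂ) * e ∈ ball (0 : ℂ) 1 := fun s hs => by
    rw [mem_ball_zero_iff, norm_mul, he, mul_one, Complex.norm_real, Real.norm_eq_abs,
      abs_of_nonneg hs.1]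
    exact hs.2
  set k : ℝ → ℂ := fun s => deriv h (s * e) + ε * deriv g (s * e) with hk
  have hk0 : ∀ s ∈ Ico (0 : ℝ) 1, k s ≠ 0 := by
    intro s hs h0
    have hlt := hp.norm_deriv_lt _ (hmem s hs)
    have h1 : ‖deriv h (s * e)‖ = ‖ε * deriv g (s * e)‖ := by
      rw [eq_neg_of_add_eq_zero_left h0, norm_neg]
    rw [norm_mul] at h1
    nlinarith [norm_nonneg (deriv g (s * e)), norm_nonneg ε]
  have hline : ∀ s : ℝ, HasDerivAt (fun s : ℝ => (s : ℂ) * e) e s := fun s => by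
    simpa using (Complex.ofRealCLM.hasDerivAt (x := s)).mul_const e
  have hkd : ∀ s ∈ Ico (0 : ℝ) 1, HasDerivAt k
      ((deriv (deriv h) (s * e) + ε * deriv (deriv g) (s * e)) * e) s := by
    intro s hs
    have a1 := (hp.analytic_left.deriv _ (hmem s hs)).differentiableAt.hasDerivAt.comp s (hline s)
    have a2 := (hp.analytic_right.deriv _ (hmem s hs)).differentiableAt.hasDerivAt.comp s (hline s)
    exact (a1.add (a2.const_mul ε)).congr_deriv (by ring)
  have hk00 : k 0 = 1 := by simp [hk, hh0, hg0]
  have hD0 : Real.log (distortionBound α 0) = 0 := by simp [distortionBound]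
  have hbound := fun s (hs : s ∈ Ico (0 : ℝ) 1) => abs_le.1 (hp.abs_re_sub_le hs hε he)
  have hpos : ∀ s ∈ Ico (0 : ℝ) 1, 0 < 1 - s ^ 2 := fun s hs => by nlinarith [hs.1, hs.2]
  have hint : interior (Ico (0 : ℝ) 1) ⊆ Ico 0 1 := interior_subset
  have hnt : 0 < ‖k t‖ := norm_pos_iff.2 (hk0 t ht)
  have hlog : Real.log (‖k t‖ ^ 2) = 2 * Real.log ‖k t‖ := by rw [Real.log_pow]; norm_num
  constructor
  · have hd : ∀ s ∈ Ico (0 : ℝ) 1, HasDerivAt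
        (fun s => Real.log (‖k s‖ ^ 2) - 2 * Real.log (distortionBound α (-s)))
        (2 * ((deriv (deriv h) (s * e) + ε * deriv (deriv g) (s * e)) * e / k s).re -
          2 * ((2 * α + 2 * (-s)) / (1 - (-s) ^ 2) * (-1))) s := by
      intro s hs
      have hD := hasDerivAt_log_distortionBound (α := α) (t := -s) (by linarith [hs.2])
        (by linarith [hs.1])
      exact (hasDerivAt_log_norm_sq (hkd s hs) (hk0 s hs)).sub
        ((hD.comp s (hasDerivAt_neg s)).const_mul 2)
    have hmono := monotoneOn_of_deriv_nonneg (convex_Ico (0 : ℝ) 1)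
      (fun s hs => (hd s hs).continuousAt.continuousWithinAt)
      (fun s hs => (hd s (hint hs)).differentiableAt.differentiableWithinAt) (by
        intro s hs
        have hs' := hint hs
        rw [(hd s hs').deriv]
        have h1 := (hbound s hs').1
        have h2 := hpos s hs'
        set X := ((deriv (deriv h) (s * e) + ε * deriv (deriv g) (s * e)) * e / k s).re
        change -α ≤ (1 - s ^ 2) / 2 * X - s at h1
        have h3 : 2 * X - 2 * ((2 * α + 2 * (-s)) / (1 - (-s) ^ 2) * (-1)) =
            4 / (1 - s ^ 2) * ((1 - s ^ 2) / 2 * X - s + α) := by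
          rw [neg_sq]
          field_simp
          ring
        rw [h3]
        exact mul_nonneg (by positivity) (by linarith))
    have := hmono (left_mem_Ico.2 one_pos) ht ht.1
    simp only [hk00, norm_one, one_pow, Real.log_one, neg_zero, hD0, mul_zero, sub_zero, hlog] at this
    refine (Real.log_le_log_iff (distortionBound_pos (by linarith [ht.2]) (by linarith [ht.1]))
      hnt).1 ?_
    linarith
  · have hd : ∀ s ∈ Ico (0 : ℝ) 1, HasDerivAt
        (fun s => Real.log (‖k s‖ ^ 2) - 2 * Real.log (distortionBound α s))
        (2 * ((deriv (deriv h) (s * e) + ε * deriv (deriv g) (s * e)) * e / k s).re -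
          2 * ((2 * α + 2 * s) / (1 - s ^ 2))) s := by
      intro s hs
      have hD := hasDerivAt_log_distortionBound (α := α) (t := s) (by linarith [hs.1]) hs.2
      exact (hasDerivAt_log_norm_sq (hkd s hs) (hk0 s hs)).sub (hD.const_mul 2)
    have hanti := antitoneOn_of_deriv_nonpos (convex_Ico (0 : ℝ) 1)
      (fun s hs => (hd s hs).continuousAt.continuousWithinAt)
      (fun s hs => (hd s (hint hs)).differentiableAt.differentiableWithinAt) (by
        intro s hs
        have hs' := hint hs
        rw [(hd s hs').deriv]
        have h1 := (hbound s hs').2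
        have h2 := hpos s hs'
        set X := ((deriv (deriv h) (s * e) + ε * deriv (deriv g) (s * e)) * e / k s).re
        change (1 - s ^ 2) / 2 * X - s ≤ α at h1
        have h3 : 2 * X - 2 * ((2 * α + 2 * s) / (1 - s ^ 2)) =
            4 / (1 - s ^ 2) * ((1 - s ^ 2) / 2 * X - s - α) := by
          field_simp
          ring
        rw [h3]
        exact mul_nonpos_of_nonneg_of_nonpos (by positivity) (by linarith))
    have := hanti (left_mem_Ico.2 one_pos) ht ht.1
    simp only [hk00, norm_one, one_pow, Real.log_one, hD0, mul_zero, sub_zero, hlog] at this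
    refine (Real.log_le_log_iff hnt
      (distortionBound_pos (by linarith [ht.1]) ht.2)).1 ?_
    linarith

/-- A rotation of `B` aligns it with `A` or with `-A`. -/
lemma exists_norm_add_mul_eq {A B : ℂ} (hAB : ‖B‖ < ‖A‖) {s : ℝ} (hs : |s| = 1) :
    ∃ ε : ℂ, ‖ε‖ ≤ 1 ∧ ‖A + ε * B‖ = ‖A‖ + s * ‖B‖ := by
  have hA : (0 : ℝ) < ‖A‖ := (norm_nonneg B).trans_lt hAB
  have hAc : (‖A‖ : ℂ) ≠ 0 := by exact_mod_cast hA.ne'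
  by_cases hB : B = 0
  · exact ⟨0, by simp, by simp [hB]⟩
  have hBn : 0 < ‖B‖ := norm_pos_iff.2 hB
  refine ⟨s * (‖B‖ * A) / (‖A‖ * B), ?_, ?_⟩
  · simp only [norm_div, norm_mul, Complex.norm_real, Real.norm_eq_abs, hs, abs_norm]
    refine le_of_eq ?_
    field_simp
  · have : A + s * (‖B‖ * A) / (‖A‖ * B) * B = (((‖A‖ + s * ‖B‖) / ‖A‖ : ℝ) : ℂ) * A := by
      push_cast
      field_simp
    have hnn : 0 ≤ (‖A‖ + s * ‖B‖) / ‖A‖ := by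
      refine div_nonneg ?_ hA.le
      have := neg_abs_le s
      rw [hs] at this
      nlinarith
    rw [this, norm_mul, Complex.norm_real, Real.norm_eq_abs, abs_of_nonneg hnn]
    field_simp

theorem AbsConvexPair.distortion {h g : ℂ → ℂ} (hp : AbsConvexPair h g)
    (hh0 : deriv h 0 = 1) (hg0 : deriv g 0 = 0) {z : ℂ} (hz : z ∈ ball (0 : ℂ) 1) :
    distortionBound absConvexOrder (-‖z‖) ≤ ‖deriv h z‖ - ‖deriv g z‖ ∧
      ‖deriv h z‖ + ‖deriv g z‖ ≤ distortionBound absConvexOrder ‖z‖ := by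
  obtain ⟨e, he, hze⟩ : ∃ e : ℂ, ‖e‖ = 1 ∧ (‖z‖ : ℂ) * e = z := by
    by_cases h0 : z = 0
    · exact ⟨1, by simp, by simp [h0]⟩
    · have hn : (‖z‖ : ℂ) ≠ 0 := by exact_mod_cast norm_ne_zero_iff.2 h0
      refine ⟨z / ‖z‖, ?_, by field_simp⟩
      rw [norm_div, Complex.norm_real, norm_norm, div_self (norm_ne_zero_iff.2 h0)]
  have ht : ‖z‖ ∈ Ico (0 : ℝ) 1 := ⟨norm_nonneg z, by simpa using hz⟩
  have hlt := hp.norm_deriv_lt z hz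
  constructor
  · obtain ⟨ε, hε, hn⟩ := exists_norm_add_mul_eq hlt (s := -1) (by simp)
    have := (hp.distortion_ray hh0 hg0 ht hε he).1
    rw [hze, hn] at this
    linarith
  · obtain ⟨ε, hε, hn⟩ := exists_norm_add_mul_eq hlt (s := 1) (by simp)
    have := (hp.distortion_ray hh0 hg0 ht hε he).2
    rw [hze, hn] at this
    linarith

/-! ### Growth -/

theorem AbsConvexPair.norm_le_growthBound {h g : ℂ → ℂ} (hp : AbsConvexPair h g)
    (h0 : h 0 = 0) (g0 : g 0 = 0) (hh0 : deriv h 0 = 1) (hg0 : deriv g 0 = 0) {z : ℂ}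
    (hz : z ∈ ball (0 : ℂ) 1) : ‖h z + conj (g z)‖ ≤ growthBound absConvexOrder ‖z‖ := by
  by_cases hz0 : z = 0
  · simp [hz0, h0, g0, growthBound_zero]
  have hz1 : ‖z‖ < 1 := by simpa using hz
  have hn : (‖z‖ : ℂ) ≠ 0 := by exact_mod_cast norm_ne_zero_iff.2 hz0
  set e : ℂ := z / ‖z‖ with he'
  have he : ‖e‖ = 1 := by
    rw [he', norm_div, Complex.norm_real, norm_norm, div_self (norm_ne_zero_iff.2 hz0)]
  have hze : (‖z‖ : ℂ) * e = z := by rw [he']; field_simp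
  have hnorm : ∀ t ∈ Icc (0 : ℝ) ‖z‖, ‖(t : ℂ) * e‖ = t := fun t ht => by
    rw [norm_mul, he, mul_one, Complex.norm_real, Real.norm_eq_abs, abs_of_nonneg ht.1]
  have hmem : ∀ t ∈ Icc (0 : ℝ) ‖z‖, (t : ℂ) * e ∈ ball (0 : ℂ) 1 := fun t ht => by
    rw [mem_ball_zero_iff, hnorm t ht]; exact ht.2.trans_lt hz1
  have hline : ∀ s : ℝ, HasDerivAt (fun s : ℝ => (s : ℂ) * e) e s := fun s => by
    simpa using (Complex.ofRealCLM.hasDerivAt (x := s)).mul_const e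
  have hd : ∀ t ∈ Icc (0 : ℝ) ‖z‖, HasDerivAt (fun t : ℝ => h (t * e) + conj (g (t * e)))
      (harmDeriv (deriv h (t * e)) (deriv g (t * e)) e) t := fun t ht =>
    (hasStrictFDerivAt_add_conj (hp.analytic_left _ (hmem t ht)).hasStrictDerivAt
      (hp.analytic_right _ (hmem t ht)).hasStrictDerivAt).hasFDerivAt.comp_hasDerivAt t (hline t)
  have hB : ∀ t ∈ Icc (0 : ℝ) ‖z‖, HasDerivAt (growthBound absConvexOrder)
      (distortionBound absConvexOrder t) t := fun t ht =>
    hasDerivAt_growthBound absConvexOrder_pos (by linarith [ht.1]) (ht.2.trans_lt hz1)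
  have := image_norm_le_of_norm_deriv_right_le_deriv_boundary'
    (f := fun t : ℝ => h (t * e) + conj (g (t * e))) (a := 0) (b := ‖z‖)
    (fun t ht => (hd t ht).continuousAt.continuousWithinAt)
    (fun t ht => (hd t (Ico_subset_Icc_self ht)).hasDerivWithinAt)
    (B := growthBound absConvexOrder) (by simp [h0, g0, growthBound_zero])
    (fun t ht => (hB t ht).continuousAt.continuousWithinAt)
    (fun t ht => (hB t (Ico_subset_Icc_self ht)).hasDerivWithinAt)
    (fun t ht => by
      have ht' := Ico_subset_Icc_self ht
      have h1 := norm_harmDeriv_le (deriv h (t * e)) (deriv g (t * e)) e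
      have h2 := (hp.distortion hh0 hg0 (hmem t ht')).2
      rw [he, mul_one] at h1
      rw [hnorm t ht'] at h2
      exact h1.trans h2)
    (right_mem_Icc.2 (norm_nonneg z))
  simpa only [hze] using this

lemma hasDerivAt_norm {γ : ℝ → ℂ} {γ' : ℂ} {s : ℝ} (hγ : HasDerivAt γ γ' s) (h0 : γ s ≠ 0) :
    HasDerivAt (fun s => ‖γ s‖) (inner ℝ (γ s) γ' / ‖γ s‖) s := by
  have h1 := hγ.norm_sq.sqrt (by simpa using h0)
  simp only [Real.sqrt_sq (norm_nonneg _)] at h1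
  refine h1.congr_deriv ?_
  rw [mul_div_mul_left _ _ two_ne_zero]

/-- Lower growth estimate. The segment `[0, f z]` lies in the convex image of a disk; its preimage `γ`
under `f` satisfies `|f z| ≥ (|h'| - |g'|) |γ'|`, and `|γ|` grows from `0` to `|z|`. -/
theorem AbsConvexPair.neg_growthBound_neg_le_norm {h g : ℂ → ℂ} (hp : AbsConvexPair h g)
    (h0 : h 0 = 0) (g0 : g 0 = 0) (hh0 : deriv h 0 = 1) (hg0 : deriv g 0 = 0) {z : ℂ}
    (hz : z ∈ ball (0 : ℂ) 1) : -growthBound absConvexOrder (-‖z‖) ≤ ‖h z + conj (g z)‖ := by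
  by_cases hz0 : z = 0
  · simp [hz0, h0, g0, growthBound_zero]
  have hz1 : ‖z‖ < 1 := by simpa using hz
  set F : ℂ → ℂ := fun z => h z + conj (g z) with hF
  have hF0 : F 0 = 0 := by simp [hF, h0, g0]
  set w := F z with hw
  have h0D : (0 : ℂ) ∈ ball (0 : ℂ) 1 := mem_ball_self one_pos
  have hw0 : w ≠ 0 := fun hw0 => hz0 (hp.injOn hz h0D (hw0.trans hF0.symm))
  set r := (1 + ‖z‖) / 2 with hr
  have hr1 : r < 1 := by rw [hr]; linarith
  have hzr : ‖z‖ < r := by rw [hr]; linarith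
  have hr0 : 0 < r := (norm_nonneg z).trans_lt hzr
  have hconv := hp.convex_image 0 h0D r ⟨hr0, by simpa using hr1⟩
  have hbD : ball (0 : ℂ) r ⊆ ball 0 1 := ball_subset_ball hr1.le
  have hex : ∀ s ∈ Icc (0 : ℝ) 1, ∃ x ∈ ball (0 : ℂ) r, F x = s • w := by
    intro s hs
    have := hconv.smul_mem_of_zero_mem ⟨0, mem_ball_self hr0, hF0⟩
      ⟨z, by simpa using hzr, rfl⟩ hs
    obtain ⟨x, hx, he⟩ := this
    exact ⟨x, hx, he⟩
  choose! γ hγr hγF using hex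
  have hγD : ∀ s ∈ Icc (0 : ℝ) 1, γ s ∈ ball (0 : ℂ) 1 := fun s hs => hbD (hγr s hs)
  have hγ0 : γ 0 = 0 := hp.injOn (hγD 0 (by simp)) h0D (by
    show F (γ 0) = F 0
    rw [hγF 0 (by simp), hF0, zero_smul])
  have hγ1 : γ 1 = z := hp.injOn (hγD 1 (by simp)) hz (by
    show F (γ 1) = F z
    rw [hγF 1 (by simp), one_smul])
  have hγd : ∀ s ∈ Icc (0 : ℝ) 1, ∃ γ' : ℂ, HasDerivWithinAt γ γ' (Icc 0 1) s ∧
      harmDeriv (deriv h (γ s)) (deriv g (γ s)) γ' = w := by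
    intro s hs
    have hsD := hγD s hs
    obtain ⟨σ, T, hσ, hT, hσT, hσr⟩ := exists_local_section (hp.analytic_left _ hsD)
      (hp.analytic_right _ hsD) (hp.norm_deriv_lt _ hsD)
    have hFs : h (γ s) + conj (g (γ s)) = s • w := hγF s hs
    rw [hFs] at hσ hσT hσr
    have hl : HasDerivAt (fun s : ℝ => s • w) w s := by
      simpa using (hasDerivAt_id s).smul_const w
    have hd : HasDerivAt (fun s : ℝ => σ (s • w)) (T w) s := hσT.comp_hasDerivAt s hl
    refine ⟨T w, hd.hasDerivWithinAt.congr_of_eventuallyEq ?_ hσ.symm, hT w⟩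
    have hmem : ∀ᶠ s' in 𝓝 s, σ (s' • w) ∈ ball (0 : ℂ) 1 :=
      hd.continuousAt.eventually_mem (isOpen_ball.mem_nhds (by simpa only [hσ] using hsD))
    filter_upwards [nhdsWithin_le_nhds hmem,
      nhdsWithin_le_nhds (hl.continuousAt.eventually hσr), self_mem_nhdsWithin] with s' h1 h2 h3
    refine hp.injOn (hγD s' h3) h1 ?_
    exact (hγF s' h3).trans h2.symm
  have hγc : ContinuousOn γ (Icc 0 1) := fun s hs => by
    obtain ⟨γ', h1, -⟩ := hγd s hs
    exact h1.continuousWithinAt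
  have hLd : ∀ t ∈ Ico (0 : ℝ) 1, HasDerivAt (fun t => -growthBound absConvexOrder (-t))
      (distortionBound absConvexOrder (-t)) t := by
    intro t ht
    have := ((hasDerivAt_growthBound absConvexOrder_pos (t := -t) (by linarith [ht.2])
      (by linarith [ht.1])).comp t (hasDerivAt_neg t)).neg
    exact this.congr_deriv (by ring)
  have hnγ : ∀ s ∈ Icc (0 : ℝ) 1, ‖γ s‖ ∈ Ico (0 : ℝ) 1 := fun s hs =>
    ⟨norm_nonneg _, by simpa using hγD s hs⟩
  -- the derivative is taken on the open interval, since `|γ|` need not be differentiable at `γ 0 = 0`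
  have hder : ∀ s ∈ Ioo (0 : ℝ) 1, ∃ d : ℝ, 0 ≤ d ∧
      HasDerivAt (fun s => s * ‖w‖ - -growthBound absConvexOrder (-‖γ s‖)) d s := by
    intro s hs
    have hs' := Ioo_subset_Icc_self hs
    obtain ⟨γ', hd, hγ'⟩ := hγd s hs'
    have hd' := hd.hasDerivAt (Icc_mem_nhds hs.1 hs.2)
    have hγne : γ s ≠ 0 := by
      intro hz
      have := hγF s hs'
      rw [hz, hF0] at this
      exact (smul_ne_zero hs.1.ne' hw0) this.symm
    have hL := (hLd _ (hnγ s hs')).comp s (hasDerivAt_norm hd' hγne)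
    have hlin : HasDerivAt (fun s : ℝ => s * ‖w‖) ‖w‖ s := by
      simpa using (hasDerivAt_id s).mul_const ‖w‖
    refine ⟨_, ?_, hlin.sub hL⟩
    have hi : inner ℝ (γ s) γ' / ‖γ s‖ ≤ ‖γ'‖ := by
      rw [div_le_iff₀ (norm_pos_iff.2 hγne), mul_comm]
      exact real_inner_le_norm _ _
    have hD := (hp.distortion hh0 hg0 (hγD s hs')).1
    have hDp : 0 < distortionBound absConvexOrder (-‖γ s‖) :=
      distortionBound_pos (by linarith [(hnγ s hs').2]) (by linarith [(hnγ s hs').1])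
    have hlow := norm_harmDeriv_ge (deriv h (γ s)) (deriv g (γ s)) γ'
    rw [hγ'] at hlow
    have h1 := mul_le_mul_of_nonneg_left hi hDp.le
    have h2 := mul_le_mul_of_nonneg_right hD (norm_nonneg γ')
    linarith
  have hmono := monotoneOn_of_deriv_nonneg (convex_Icc (0 : ℝ) 1)
    (f := fun s => s * ‖w‖ - -growthBound absConvexOrder (-‖γ s‖))
    (fun s hs => by
      refine ContinuousWithinAt.sub (by fun_prop) ?_
      exact ContinuousAt.comp_continuousWithinAt
        (g := fun t => -growthBound absConvexOrder (-t)) (hLd _ (hnγ s hs)).continuousAt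
        (hγc s hs).norm)
    (fun s hs => by
      rw [interior_Icc] at hs
      obtain ⟨d, -, hd⟩ := hder s hs
      exact hd.differentiableAt.differentiableWithinAt)
    (fun s hs => by
      rw [interior_Icc] at hs
      obtain ⟨d, hd0, hd⟩ := hder s hs
      rwa [hd.deriv])
  have := hmono (left_mem_Icc.2 zero_le_one) (right_mem_Icc.2 zero_le_one) zero_le_one
  simp only [hγ0, hγ1, norm_zero, neg_zero, growthBound_zero, zero_mul, sub_zero, one_mul] at this
  linarith

/-! ### Covering -/

lemma tendsto_neg_growthBound_neg {α : ℝ} (hα : 0 < α) :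
    Tendsto (fun r => -growthBound α (-r)) (𝓝[<] 1) (𝓝 (1 / (2 * α))) := by
  have hq : ContinuousAt (fun r : ℝ => -((((1 + -r) / (1 - -r)) ^ α - 1) / (2 * α))) 1 := by
    refine (((ContinuousAt.rpow_const ?_ (Or.inr hα.le)).sub continuousAt_const).div_const _).neg
    exact (continuousAt_const.add continuousAt_id.neg).div
      (continuousAt_const.sub continuousAt_id.neg) (by norm_num)
  have := hq.tendsto.mono_left (nhdsWithin_le_nhds (s := Iio 1))
  have hval : -((((1 + -1) / (1 - -1) : ℝ) ^ α - 1) / (2 * α)) = 1 / (2 * α) := by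
    have : ((1 + -1) / (1 - -1) : ℝ) = 0 := by norm_num
    rw [this, Real.zero_rpow hα.ne']
    ring
  rw [hval] at this
  exact this

/-- Covering theorem. The lower growth estimate keeps the image of a circle `|z| = r` outside a ball
about `0`, and a connected set that avoids this image and meets the image of `|z| < r` lies in the
latter. -/
theorem AbsConvexPair.ball_subset_image {h g : ℂ → ℂ} (hp : AbsConvexPair h g)
    (h0 : h 0 = 0) (g0 : g 0 = 0) (hh0 : deriv h 0 = 1) (hg0 : deriv g 0 = 0) :
    ball (0 : ℂ) (1 / (2 * absConvexOrder)) ⊆ (fun z => h z + conj (g z)) '' ball 0 1 := by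
  intro y hy
  set F : ℂ → ℂ := fun z => h z + conj (g z) with hF
  have hF0 : F 0 = 0 := by simp [hF, h0, g0]
  rw [mem_ball_zero_iff] at hy
  obtain ⟨r, hyr, hr0, hr1⟩ := (((tendsto_neg_growthBound_neg absConvexOrder_pos).eventually_const_lt
    hy).and (Ioo_mem_nhdsLT zero_lt_one)).exists
  have hcD : closedBall (0 : ℂ) r ⊆ ball 0 1 := closedBall_subset_ball hr1
  have hbD : ball (0 : ℂ) r ⊆ ball 0 1 := ball_subset_ball hr1.le
  have hopen : IsOpen (F '' ball 0 r) := isOpen_image_add_conj isOpen_ball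
    (fun z hz => hp.analytic_left z (hbD hz)) (fun z hz => hp.analytic_right z (hbD hz))
    (fun z hz => hp.norm_deriv_lt z (hbD hz))
  have hclosed : IsClosed (F '' closedBall 0 r) := by
    refine ((isCompact_closedBall (0 : ℂ) r).image_of_continuousOn fun z hz => ?_).isClosed
    exact (continuousAt_add_conj (hp.analytic_left z (hcD hz))
      (hp.analytic_right z (hcD hz))).continuousWithinAt
  have hsub : ball (0 : ℂ) (-growthBound absConvexOrder (-r)) ⊆ F '' ball 0 r := by
    refine (convex_ball _ _).isPreconnected.subset_of_closure_inter_subset hopen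
      ⟨0, mem_ball_self ((norm_nonneg y).trans_lt hyr), 0, mem_ball_self hr0, hF0⟩ ?_
    rintro v ⟨hv, hvb⟩
    obtain ⟨x, hx, rfl⟩ := closure_minimal (image_mono ball_subset_closedBall) hclosed hv
    refine ⟨x, ?_, rfl⟩
    rw [mem_closedBall_zero_iff] at hx
    rw [mem_ball_zero_iff] at hvb ⊢
    refine lt_of_le_of_ne hx fun hxr => ?_
    have := hp.neg_growthBound_neg_le_norm h0 g0 hh0 hg0 (z := x)
      (hcD (by simpa using hx))
    rw [hxr] at this
    exact absurd hvb (not_lt.2 this)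
  exact image_mono hbD (hsub (by simpa using hyr))

lemma taylorCoeff_two (h : ℂ → ℂ) : taylorCoeff h 2 = deriv (deriv h) 0 / 2 := by
  simp [taylorCoeff, iteratedDeriv_succ, iteratedDeriv_zero]

lemma AbsConvexPair.norm_taylorCoeff_two_le {h g : ℂ → ℂ} (hp : AbsConvexPair h g)
    (hh0 : deriv h 0 = 1) (hg0 : deriv g 0 = 0) : ‖taylorCoeff h 2‖ ≤ 2 / √3 := by
  have := hp.norm_preSchwarzian_le (mem_ball_self one_pos) hg0
  rw [hh0] at this
  rw [taylorCoeff_two]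
  convert this using 2
  simp
  ring

end HarmonicMapping

theorem theorem2 (f : ℂ → ℂ) (hf : f ∈ HarmonicMapping.classAK0) :
    (∀ h g : ℂ → ℂ, HarmonicMapping.IsNormalizedDecomp f h g →
      ‖HarmonicMapping.taylorCoeff h 2‖ ≤ 2 / Real.sqrt 3) ∧
    (∀ z : ℂ, 0 < ‖z‖ → ‖z‖ < 1 →
      (Real.sqrt 3 / (Real.sqrt 3 + 4)) *
          (1 - ((1 - ‖z‖) / (1 + ‖z‖)) ^ ((Real.sqrt 3 + 4) / (2 * Real.sqrt 3))) ≤ ‖f z‖ ∧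
      ‖f z‖ ≤ (Real.sqrt 3 / (Real.sqrt 3 + 4)) *
          (((1 + ‖z‖) / (1 - ‖z‖)) ^ ((Real.sqrt 3 + 4) / (2 * Real.sqrt 3)) - 1)) ∧
    Metric.ball (0 : ℂ) (Real.sqrt 3 / (Real.sqrt 3 + 4)) ⊆ f '' Metric.ball (0 : ℂ) 1 := by
  obtain ⟨hAK, h, g, hd, hg0⟩ := hf
  have hp := HarmonicMapping.AbsConvexPair.of_mem_classAK hAK hd hg0
  refine ⟨fun h₁ g₁ hd₁ => ?_, fun z _ hz => ?_, ?_⟩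
  · have h0D : (0 : ℂ) ∈ Metric.ball (0 : ℂ) 1 := Metric.mem_ball_self one_pos
    have hg₁0 : deriv g₁ 0 = 0 := by
      rw [← (HarmonicMapping.deriv_eq_of_decomp hd hd₁ h0D).2, hg0]
    exact (HarmonicMapping.AbsConvexPair.of_mem_classAK hAK hd₁ hg₁0).norm_taylorCoeff_two_le
      hd₁.deriv_h_zero hg₁0
  · have hzD : z ∈ Metric.ball (0 : ℂ) 1 := by simpa using hz
    have hlow := hp.neg_growthBound_neg_le_norm hd.h_zero hd.g_zero hd.deriv_h_zero hg0 hzD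
    have hup := hp.norm_le_growthBound hd.h_zero hd.g_zero hd.deriv_h_zero hg0 hzD
    rw [HarmonicMapping.growthBound_absConvexOrder] at hlow hup
    rw [← hd.eq_add_conj z hzD] at hlow hup
    rw [← sub_eq_add_neg, sub_neg_eq_add] at hlow
    exact ⟨by linarith, hup⟩
  · have hsub := hp.ball_subset_image hd.h_zero hd.g_zero hd.deriv_h_zero hg0
    rw [← Set.EqOn.image_eq hd.eq_add_conj] at hsub
    have hr : Real.sqrt 3 / (Real.sqrt 3 + 4) = 1 / (2 * HarmonicMapping.absConvexOrder) := by
      have h3 : Real.sqrt 3 ≠ 0 := by positivity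
      rw [HarmonicMapping.absConvexOrder_eq]
      field_simp
    rw [hr]
    exact hsub
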